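/- A planar linkage $L$ with revolute joints is a finite connected simple graph whose vertices are called links and whose edges are called joints, together with a point $\rho(e)\in\mathbb{R}^2$ (center of rotation) for every joint $e$. A configuration of $L$ assigns to every ordered pair $(k,l)$ of neighboring links a rotation $\sigma_{k,l}\in SE(2)$ around $\rho(\{k,l\})$ such that the composition of these rotations along every directed cycle is the identity. The rotations around a fixed point form a projective line, so the configurations form a projective subvariety of $(\mathbb{P}^1_{\mathbb{R}})^{2|E|}$, whose dimension is called the mobility of $L$. A relative position of the links $i,j$ is the composition, in some configuration, of the rotations along a path from $i$ to $j$. The group $SE(2)$ is embedded as the open set $x_1^2+x_2^2\neq 0$ in $\mathbb{P}^3_{\mathbb{R}}$: with $z=x_1+\mathrm{i}x_2$ and $w=y_1+\mathrm{i}y_2$, the point $(x_1:x_2:y_1:y_2)$ acts on $\mathbb{R}^2=\mathbb{C}$ by $u\mapsto (uz^2+zw)/|z|^2$. A rational motion is a map $\Phi\colon\mathbb{R}\dashrightarrow\mathbb{P}^3_{\mathbb{R}}$ given by real polynomials $(X_1,X_2,Y_1,Y_2)$ with $X_1^2+X_2^2\not\equiv 0$, defined away from their common real zeros. The linkage $L$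 strongly realizes $\Phi$ if for some links $i,j$ the image of $\Phi$ is contained in the set of relative positions of $i,j$ and its Zariski closure in that set is an irreducible component of it. Finally, $L$ draws a plane curve $\mathcal{C}\subseteq\mathbb{R}^2$ if it strongly realizes a rational motion under which the orbit of some point of the plane is $\mathcal{C}$. Proposition. Let $f,g,h\in\mathbb{R}[t]$ with $h$ monic and $d:=\deg h>\max\{\deg f,\deg g\}$ (where $\deg 0=-\infty$), and suppose that the curve parametrized by $$\varphi(t)=\left(\frac{f(t)}{h(t)},\frac{g(t)}{h(t)}\right),\qquad t\in\mathbb{R},\ h(t)\neq 0,$$ is bounded. Then there exists a linkage of mobility one with at most $3d+2$ links and at most $\frac{9}{2}d+1$ joints that draws the image of $\varphi$. -/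

import Mathlib

open Polynomial

/-- The Euclidean plane is identified with `ℂ`. `SE2` is the group of direct isometries of the
plane, i.e. isometries whose linear part has determinant `1`; multiplication is composition,
`(σ * τ) u = σ (τ u)`. -/
def SE2 : Subgroup (ℂ ≃ᵃⁱ[ℝ] ℂ) where
  carrier := {σ | LinearMap.det (σ.linearIsometryEquiv.toLinearEquiv : ℂ →ₗ[ℝ] ℂ) = 1}
  one_mem' := LinearMap.det_id
  mul_mem' := by
    intro σ τ hσ hτ
    have h := LinearMap.det_comp (σ.linearIsometryEquiv.toLinearEquiv : ℂ →ₗ[ℝ] ℂ)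
      (τ.linearIsometryEquiv.toLinearEquiv : ℂ →ₗ[ℝ] ℂ)
    exact h.trans (by rw [hσ, hτ, one_mul])
  inv_mem' := by
    intro σ hσ
    have h := LinearEquiv.det_symm_mul_det σ.linearIsometryEquiv.toLinearEquiv
    rw [Set.mem_ofPred_eq] at hσ
    rw [hσ, mul_one] at h
    exact h

namespace SE2

/-- `x = (x₁, x₂, y₁, y₂)` are homogeneous coordinates of the direct isometry `σ` in the standard
embedding of `SE(2)` into `ℙ³(ℝ)`, as the open set `x₁² + x₂² ≠ 0`: with `z = x₁ + i x₂` and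
`w = y₁ + i y₂`, the isometry is `u ↦ (u z² + z w) / |z|²`. -/
def HasCoords (x : Fin 4 → ℝ) (σ : SE2) : Prop :=
  x 0 ^ 2 + x 1 ^ 2 ≠ 0 ∧
    ∀ u : ℂ, (σ : ℂ ≃ᵃⁱ[ℝ] ℂ) u =
      (u * (⟨x 0, x 1⟩ : ℂ) ^ 2 + (⟨x 0, x 1⟩ : ℂ) * (⟨x 2, x 3⟩ : ℂ)) /
        ((x 0 ^ 2 + x 1 ^ 2 : ℝ) : ℂ)

/-- The Zariski topology on `SE(2)`, as a subspace of `ℙ³(ℝ)`: the basic open sets are the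
non-vanishing loci of homogeneous polynomials in the four coordinates. -/
instance zariskiTopology : TopologicalSpace SE2 :=
  TopologicalSpace.generateFrom
    {U | ∃ (m : ℕ) (p : MvPolynomial (Fin 4) ℝ), p.IsHomogeneous m ∧
      U = {σ | ∃ x, HasCoords x σ ∧ MvPolynomial.eval x p ≠ 0}}

/-- The subgroup of rotations around the point `c`. -/
def rotations (c : ℂ) : Subgroup SE2 where
  carrier := {σ | (σ : ℂ ≃ᵃⁱ[ℝ] ℂ) c = c}
  one_mem' := rfl
  mul_mem' := by
    intro σ τ hσ hτ
    exact (congrArg (σ : ℂ ≃ᵃⁱ[ℝ] ℂ) hτ).trans hσ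
  inv_mem' := by
    intro σ hσ
    have h : (σ : ℂ ≃ᵃⁱ[ℝ] ℂ).symm ((σ : ℂ ≃ᵃⁱ[ℝ] ℂ) c) = c :=
      AffineIsometryEquiv.symm_apply_apply _ c
    rw [Set.mem_ofPred_eq] at hσ
    rw [hσ] at h
    exact h

/-- The coordinates in `ℙ³(ℝ)` of the rotation around `c` with parameter `(y 0 : y 1) ∈ ℙ¹(ℝ)`;
they have `z = y 0 + i (y 1)` and `w = c (z̄ - z)`. For fixed `c` and varying `(y 0 : y 1)`, this
identifies the rotations around `c` with `ℙ¹(ℝ)`. -/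
def rotationCoords (c : ℂ) (y : Fin 2 → ℝ) : Fin 4 → ℝ :=
  ![y 0, y 1, 2 * c.im * y 1, -2 * c.re * y 1]

end SE2

/-- A planar linkage with revolute joints: a connected undirected graph without loops, whose
vertices are the links and whose edges are the joints, with a center of rotation in the plane for
every joint. -/
structure Linkage where
  numLinks : ℕ
  graph : SimpleGraph (Fin numLinks)
  connected : graph.Connected
  center : graph.edgeSet → ℂ

namespace Linkage

/-- The number of joints. -/
noncomputable def numJoints (L : Linkage) : ℕ := L.graph.edgeSet.ncard

/-- The center of rotation of the joint underlying an oriented edge. -/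
def dartCenter (L : Linkage) (e : L.graph.Dart) : ℂ := L.center ⟨e.edge, e.edge_mem⟩

/-- A configuration: for each ordered pair `(k, l)` of neighboring links a rotation `σ_{k,l}`
around the center of their joint, such that the composition along every directed cycle (every
closed sequence of neighboring links) is the identity. -/
@[ext]
structure Configuration (L : Linkage) where
  pos : L.graph.Dart → SE2
  pos_mem : ∀ e, pos e ∈ SE2.rotations (L.dartCenter e)
  cycle : ∀ (i : Fin L.numLinks) (c : L.graph.Walk i i), (c.darts.map pos).prod = 1

/-- The Zariski topology on the set of configurations, as a subset of `ℙ¹(ℝ) ^ (2 |E|)`: the basic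
open sets are the non-vanishing loci of multihomogeneous polynomials. -/
instance zariskiTopology (L : Linkage) : TopologicalSpace L.Configuration :=
  TopologicalSpace.generateFrom
    {U | ∃ (m : L.graph.Dart → ℕ) (p : MvPolynomial (L.graph.Dart × Fin 2) ℝ),
      (∀ e, p.IsWeightedHomogeneous (fun v => if v.1 = e then 1 else 0) (m e)) ∧
      U = {S | ∃ y : L.graph.Dart → Fin 2 → ℝ,
        (∀ e, SE2.HasCoords (SE2.rotationCoords (L.dartCenter e) (y e)) (S.pos e)) ∧
        MvPolynomial.eval (fun v => y v.1 v.2) p ≠ 0}}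

/-- The mobility of a linkage: the dimension of its configuration space. -/
noncomputable def mobility (L : Linkage) : WithBot ℕ∞ := topologicalKrullDim L.Configuration

/-- The set of relative positions of the links `i` and `j`: all compositions
`σ_{i,h₁} ∘ σ_{h₁,h₂} ∘ ⋯ ∘ σ_{h_s,j}` in all configurations. By the cycle condition the composition
does not depend on the path from `i` to `j`. -/
def relativePositions (L : Linkage) (i j : Fin L.numLinks) : Set SE2 :=
  {σ | ∃ (S : L.Configuration) (w : L.graph.Walk i j), σ = (w.darts.map S.pos).prod}

end Linkage

/-- A rational motion `ℝ ⇢ ℙ³(ℝ)`, given by four real polynomials `X₁, X₂, Y₁, Y₂` with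
`X₁² + X₂²` not identically zero. It is defined at all `t` that are not common zeros. -/
structure RationalMotion where
  poly : Fin 4 → ℝ[X]
  ne_zero : poly 0 ^ 2 + poly 1 ^ 2 ≠ 0

namespace RationalMotion

/-- The homogeneous coordinates of the motion at time `t`. -/
noncomputable def coords (Φ : RationalMotion) (t : ℝ) : Fin 4 → ℝ := fun k => (Φ.poly k).eval t

/-- The isometries in the image of the motion. -/
def image (Φ : RationalMotion) : Set SE2 := {σ | ∃ t, SE2.HasCoords (Φ.coords t) σ}

/-- The orbit of a point of the plane under the motion. -/
def orbit (Φ : RationalMotion) (u : ℂ) : Set ℂ := {v | ∃ σ ∈ Φ.image, v = (σ : ℂ ≃ᵃⁱ[ℝ] ℂ) u}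

end RationalMotion

namespace Linkage

/-- `L` strongly realizes the rational motion `Φ`: for some links `i`, `j` the whole image of `Φ` in
`ℙ³(ℝ)` (in particular no point outside `SE(2)`) lies in the set of relative positions of `i` and
`j`, and the Zariski closure of the image in that set is one of its irreducible components. -/
def StronglyRealizes (L : Linkage) (Φ : RationalMotion) : Prop :=
  ∃ i j : Fin L.numLinks,
    (∀ t, Φ.coords t ≠ 0 → ∃ σ ∈ L.relativePositions i j, SE2.HasCoords (Φ.coords t) σ) ∧
    closure ((↑) ⁻¹' Φ.image : Set (L.relativePositions i j)) ∈
      irreducibleComponents (L.relativePositions i j)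

/-- `L` draws the plane curve `C`: it strongly realizes a rational motion under which the orbit of
some point (the pen) is `C`. -/
def Draws (L : Linkage) (C : Set ℂ) : Prop :=
  ∃ Φ : RationalMotion, L.StronglyRealizes Φ ∧ ∃ u : ℂ, Φ.orbit u = C

end Linkage

/-- The image of the rational parametrization `t ↦ (f(t)/h(t), g(t)/h(t))`, where `t` runs over all
reals at which it is defined. -/
def rationalCurve (f g h : ℝ[X]) : Set ℂ :=
  {u | ∃ t : ℝ, h.eval t ≠ 0 ∧ u = ⟨f.eval t / h.eval t, g.eval t / h.eval t⟩}

/-!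
The curve is drawn by a ladder of antiparallelograms.

A rotation about a fixed center whose angle is given by a linear polynomial `t - α` with non-real
root `α` has linear part `(t - α) / (t - conj α)`, so a product of `n` such rotations moves the
origin along a rational curve with denominator `∏ (t - conj (α k))`. After cancelling the common
factor of `f`, `g`, `h`, which affects only the excluded parameters, boundedness leaves a
denominator without real zeros, `∏ (t - β j) (t - conj (β j))` with `m` roots `β j` in the upper half
plane. Split `(f + i g) / h` into partial fractions with denominators `∏ (t - β j)` and
`∏ (t - conj (β j))`. Rotations with roots `conj (β j)` produce the first fraction, rotations with
roots `β j` around the origin undo their total rotation, and rotations with roots `β j` once more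
produce the second one (`exists_railMotion`); this takes `n = 3 m` rotations.

The open chain with these `n` joints gets mobility one by adding a second rail and rungs. All rungs
rotate with one further root `γ`. If two rotations with the same parameter `t` and roots `α`, `γ` are
given, a product of them in one order is also a product in the other order, with new centers; the
four centers form an antiparallelogram (`antiparallelogram_closed`). Hence the ladder has a motion
in which all joints have the same parameter. Conversely, a quadrilateral whose opposite sides are
equal and whose adjacent sides are not has only two positions for a given angle, both
rational in terms of it (`quadrilateral_cases`), so the whole configuration space is a finite union
of sets on which everything is a rational function of one real parameter
(`hasArcCover_antiLadder`). The squares are non-degenerate for all but finitely many positions of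
the first rung (`exists_nondegenerate`).

For the Zariski topology, a space covered by finitely many such arcs has dimension one, and the
closure of any infinite arc is an irreducible component
(`topologicalKrullDim_eq_one_of_arcs`, `IsRationalArc.closure_mem_irreducibleComponents`). The key
point is that an infinite arc in the closure of another one is dense in it, because two rational
functions of one variable are algebraically dependent
(`IsRationalArc.subset_closure_of_subset_closure`). These facts are proved for affine coordinates;
`isPolyBasis_of_homogeneous` shows that the topologies defined by homogeneous coordinates agree with
the affine ones.
-/

/-! ### Rational arcs in affine real algebraic sets -/

/-- The topology of `X` is the Zariski topology with respect to the real coordinate functions `e k`: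
the non-vanishing loci of polynomials in these coordinates form a basis. -/
def IsPolyBasis {X ι : Type*} [TopologicalSpace X] (e : ι → X → ℝ) : Prop :=
  TopologicalSpace.IsTopologicalBasis
    {U : Set X | ∃ p : MvPolynomial ι ℝ, U = {x | MvPolynomial.eval (fun k => e k x) p ≠ 0}}

/-- On the set `A`, the function `φ` is a rational function, without poles on `A`, of the real
parameter `θ`. -/
def RationalOn {X : Type*} (A : Set X) (θ φ : X → ℝ) : Prop :=
  ∃ P Q : ℝ[X], ∀ x ∈ A, Q.eval (θ x) ≠ 0 ∧ φ x = P.eval (θ x) / Q.eval (θ x)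

namespace RationalOn

variable {X : Type*} {A : Set X} {θ φ ψ : X → ℝ}

lemma mono {B : Set X} (h : RationalOn A θ φ) (hB : B ⊆ A) : RationalOn B θ φ := by
  obtain ⟨P, Q, h⟩ := h
  exact ⟨P, Q, fun x hx => h x (hB hx)⟩

lemma congr (h : RationalOn A θ φ) (hψ : ∀ x ∈ A, ψ x = φ x) : RationalOn A θ ψ := by
  obtain ⟨P, Q, h⟩ := h
  exact ⟨P, Q, fun x hx => ⟨(h x hx).1, (hψ x hx).trans (h x hx).2⟩⟩

lemma const (c : ℝ) : RationalOn A θ fun _ => c :=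
  ⟨C c, 1, fun _ _ => by simp⟩

lemma param : RationalOn A θ θ := ⟨Polynomial.X, 1, fun _ _ => by simp⟩

lemma add (h : RationalOn A θ φ) (h' : RationalOn A θ ψ) :
    RationalOn A θ fun x => φ x + ψ x := by
  obtain ⟨P, Q, h⟩ := h
  obtain ⟨P', Q', h'⟩ := h'
  refine ⟨P * Q' + Q * P', Q * Q', fun x hx => ?_⟩
  obtain ⟨h1, h2⟩ := h x hx
  obtain ⟨h3, h4⟩ := h' x hx
  simp only [eval_mul, eval_add]
  exact ⟨mul_ne_zero h1 h3, by rw [h2, h4, div_add_div _ _ h1 h3]⟩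

lemma mul (h : RationalOn A θ φ) (h' : RationalOn A θ ψ) :
    RationalOn A θ fun x => φ x * ψ x := by
  obtain ⟨P, Q, h⟩ := h
  obtain ⟨P', Q', h'⟩ := h'
  refine ⟨P * P', Q * Q', fun x hx => ?_⟩
  obtain ⟨h1, h2⟩ := h x hx
  obtain ⟨h3, h4⟩ := h' x hx
  simp only [eval_mul]
  exact ⟨mul_ne_zero h1 h3, by rw [h2, h4, div_mul_div_comm]⟩

lemma neg (h : RationalOn A θ φ) : RationalOn A θ fun x => -φ x :=
  ((const (-1)).mul h).congr fun _ _ => by simp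

lemma sub (h : RationalOn A θ φ) (h' : RationalOn A θ ψ) :
    RationalOn A θ fun x => φ x - ψ x :=
  (h.add h'.neg).congr fun _ _ => sub_eq_add_neg _ _

lemma inv (h : RationalOn A θ φ) (h0 : ∀ x ∈ A, φ x ≠ 0) :
    RationalOn A θ fun x => (φ x)⁻¹ := by
  obtain ⟨P, Q, h⟩ := h
  refine ⟨Q, P, fun x hx => ?_⟩
  obtain ⟨h1, h2⟩ := h x hx
  refine ⟨fun h3 => h0 x hx (by rw [h2, h3, zero_div]), by simp only [h2, inv_div]⟩

lemma eval {ι : Type*} {e : ι → X → ℝ} (h : ∀ k, RationalOn A θ (e k)) (p : MvPolynomial ι ℝ) :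
    RationalOn A θ fun x => MvPolynomial.eval (fun k => e k x) p := by
  induction p using MvPolynomial.induction_on with
  | C a => simpa using const a
  | add p q hp hq => simpa using hp.add hq
  | mul_X p n hp => simpa using hp.mul (h n)

end RationalOn

/-- A set on which all coordinates are rational functions of one real parameter. -/
def IsRationalArc {X ι : Type*} (e : ι → X → ℝ) (A : Set X) : Prop :=
  ∃ θ : X → ℝ, ∀ k, RationalOn A θ (e k)

section Arcs

variable {X ι : Type*} {e : ι → X → ℝ} {A B : Set X}

lemma RationalOn.injOn (he : Function.Injective fun x k => e k x) {θ : X → ℝ}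
    (h : ∀ k, RationalOn A θ (e k)) : Set.InjOn θ A := by
  intro x hx y hy hxy
  refine he (funext fun k => ?_)
  obtain ⟨P, Q, h⟩ := h k
  simp only [(h x hx).2, (h y hy).2, hxy]

lemma RationalOn.eq_zero_or_finite (he : Function.Injective fun x k => e k x) {θ φ : X → ℝ}
    (h : ∀ k, RationalOn A θ (e k)) (hφ : RationalOn A θ φ) :
    (∀ x ∈ A, φ x = 0) ∨ {x ∈ A | φ x = 0}.Finite := by
  obtain ⟨P, Q, hPQ⟩ := hφ
  by_cases hP : P = 0
  · exact Or.inl fun x hx => by simp [(hPQ x hx).2, hP]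
  · refine Or.inr (Set.Finite.of_finite_image (f := θ) ?_
      ((RationalOn.injOn he h).mono fun x hx => hx.1))
    refine (P.roots.toFinset.finite_toSet).subset ?_
    rintro _ ⟨x, ⟨hx, hx0⟩, rfl⟩
    have h1 := (hPQ x hx).2
    rw [hx0, eq_comm, div_eq_zero_iff, or_iff_left (hPQ x hx).1] at h1
    simp [hP, h1]

variable [TopologicalSpace X]

lemma IsPolyBasis.exists_of_notMem (hb : IsPolyBasis e) {C : Set X} (hC : IsClosed C) {x : X}
    (hx : x ∉ C) : ∃ p : MvPolynomial ι ℝ, MvPolynomial.eval (fun k => e k x) p ≠ 0 ∧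
      ∀ y ∈ C, MvPolynomial.eval (fun k => e k y) p = 0 := by
  obtain ⟨U, ⟨p, rfl⟩, h1, h2⟩ := hb.exists_subset_of_mem_open (u := Cᶜ) hx hC.isOpen_compl
  exact ⟨p, h1, fun y hy => by_contra fun h => h2 h hy⟩

lemma IsPolyBasis.isClosed_zeros (hb : IsPolyBasis e) (p : MvPolynomial ι ℝ) :
    IsClosed {x | MvPolynomial.eval (fun k => e k x) p = 0} :=
  ⟨hb.isOpen ⟨p, rfl⟩⟩

lemma IsPolyBasis.t1Space (hb : IsPolyBasis e) (he : Function.Injective fun x k => e k x) :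
    T1Space X := by
  refine ⟨fun x => ?_⟩
  have : ({x} : Set X) = ⋂ k, {y | MvPolynomial.eval (fun k => e k y)
      (MvPolynomial.X k - MvPolynomial.C (e k x)) = 0} := by
    ext y
    simp only [Set.mem_singleton_iff, Set.mem_iInter, Set.mem_ofPred_eq, map_sub,
      MvPolynomial.eval_X, MvPolynomial.eval_C, sub_eq_zero]
    exact ⟨fun h k => by rw [h], fun h => he (funext h)⟩
  rw [this]
  exact isClosed_iInter fun k => hb.isClosed_zeros _

/-- A rational arc carries a topology that is at most as fine as the cofinite one. -/
lemma IsRationalArc.subset_or_finite (hb : IsPolyBasis e)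
    (he : Function.Injective fun x k => e k x) (hA : IsRationalArc e A) {C : Set X}
    (hC : IsClosed C) : A ⊆ C ∨ (A ∩ C).Finite := by
  by_contra! h
  obtain ⟨x, hx, hxC⟩ := Set.not_subset.1 h.1
  obtain ⟨p, hp, hpC⟩ := hb.exists_of_notMem hC hxC
  obtain ⟨θ, hθ⟩ := hA
  rcases RationalOn.eq_zero_or_finite he hθ (RationalOn.eval hθ p) with h0 | h0
  · exact hp (h0 x hx)
  · exact h.2 (h0.subset fun y hy => ⟨hy.1, hpC y hy.2⟩)

lemma IsRationalArc.isIrreducible (hb : IsPolyBasis e)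
    (he : Function.Injective fun x k => e k x) (hA : IsRationalArc e A) (hinf : A.Infinite) :
    IsIrreducible A := by
  refine ⟨hinf.nonempty, isPreirreducible_iff_isClosed_union_isClosed.2 ?_⟩
  intro z₁ z₂ h1 h2 h
  rcases hA.subset_or_finite hb he h1 with h3 | h3
  · exact Or.inl h3
  rcases hA.subset_or_finite hb he h2 with h4 | h4
  · exact Or.inr h4
  · exact absurd ((h3.union h4).subset fun x hx => by
      rcases h hx with h5 | h5
      exacts [Or.inl ⟨hx, h5⟩, Or.inr ⟨hx, h5⟩]) hinf

open scoped IntermediateField.algebraAdjoinAdjoin in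
/-- Two rational functions `u ≠ 0` and `w` of one variable satisfy a polynomial relation that is not
divisible by the variable standing for `u`. -/
lemma exists_ratFunc_relation (u w : RatFunc ℝ) (hu : u ≠ 0) :
    ∃ G : ℝ[X][X], G.coeff 0 ≠ 0 ∧
      G.eval₂ (aeval w : ℝ[X] →ₐ[ℝ] RatFunc ℝ).toRingHom u = 0 := by
  by_cases hw : ∃ c, w = RatFunc.C c
  · obtain ⟨c, rfl⟩ := hw
    refine ⟨C (X - C c), by simpa using X_sub_C_ne_zero c, ?_⟩
    simp [RatFunc.algebraMap_eq_C]
  · have halg := RatFunc.isAlgebraic_adjoin_simple_X' w hw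
    have h1 : IsAlgebraic (Algebra.adjoin ℝ {w}) u :=
      (IsFractionRing.isAlgebraic_iff (Algebra.adjoin ℝ {w})
        (IntermediateField.adjoin ℝ {w}) (RatFunc ℝ)).2 (halg.isAlgebraic u)
    obtain ⟨q, hq0, hq⟩ :=
      h1.exists_nonzero_coeff_and_aeval_eq_zero (mem_nonZeroDivisors_of_ne_zero hu)
    let g : ℝ[X] →+* Algebra.adjoin ℝ {w} :=
      ((aeval w : ℝ[X] →ₐ[ℝ] RatFunc ℝ).codRestrict _
        fun p => aeval_mem_adjoin_singleton ℝ w).toRingHom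
    have hg : Function.Surjective g := by
      rintro ⟨y, hy⟩
      rw [Algebra.adjoin_singleton_eq_range_aeval] at hy
      obtain ⟨p, rfl⟩ := hy
      exact ⟨p, rfl⟩
    obtain ⟨G, rfl⟩ := Polynomial.map_surjective g hg q
    refine ⟨G, fun h => hq0 (by simp [h]), ?_⟩
    rw [aeval_def, eval₂_map] at hq
    exact hq

/-- A relation between the values of two fractions in one variable, as in
`exists_ratFunc_relation`, that holds at every point where both are defined. -/
lemma exists_eval_relation (P Q P' Q' : ℝ[X]) (hP : P ≠ 0) (hQ : Q ≠ 0) :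
    ∃ G : ℝ[X][X], G.coeff 0 ≠ 0 ∧ ∀ t, Q.eval t ≠ 0 → Q'.eval t ≠ 0 →
      G.eval₂ (evalRingHom (P'.eval t / Q'.eval t)) (P.eval t / Q.eval t) = 0 := by
  have hinj : Function.Injective (algebraMap ℝ[X] (RatFunc ℝ)) := IsFractionRing.injective _ _
  obtain ⟨G, hG0, hG⟩ := exists_ratFunc_relation
    (algebraMap ℝ[X] (RatFunc ℝ) P / algebraMap ℝ[X] (RatFunc ℝ) Q)
    (algebraMap ℝ[X] (RatFunc ℝ) P' / algebraMap ℝ[X] (RatFunc ℝ) Q')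
    (div_ne_zero ((map_ne_zero_iff _ hinj).2 hP) ((map_ne_zero_iff _ hinj).2 hQ))
  refine ⟨G, hG0, fun t h1 h2 => ?_⟩
  -- The relation is transported from the field of rational functions to `ℝ` through the
  -- localization at the polynomials that do not vanish at `t`.
  let M : Submonoid ℝ[X] := (nonZeroDivisors ℝ).comap (evalRingHom t)
  have hM : ∀ q ∈ M, q.eval t ≠ 0 := fun q hq => nonZeroDivisors.ne_zero hq
  have hM' : ∀ q, q.eval t ≠ 0 → q ∈ M := fun q hq => mem_nonZeroDivisors_of_ne_zero hq
  have hu1 : ∀ y : M, IsUnit (algebraMap ℝ[X] (RatFunc ℝ) y) := fun y =>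
    ((map_ne_zero_iff _ hinj).2 fun h => hM y y.2 (by rw [h, eval_zero])).isUnit
  have hu2 : ∀ y : M, IsUnit (evalRingHom t y) := fun y => (hM y y.2).isUnit
  let a : Localization M →+* RatFunc ℝ := IsLocalization.lift hu1
  let b : Localization M →+* ℝ := IsLocalization.lift hu2
  have ha : Function.Injective a := by
    rw [IsLocalization.lift_injective_iff]
    intro x y
    refine ⟨fun h => ?_, fun h => ?_⟩
    · rw [IsLocalization.injective (Localization M)
        (fun q hq => mem_nonZeroDivisors_of_ne_zero fun h0 => hM q hq (by rw [h0, eval_zero])) h]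
    · rw [hinj h]
  let u := IsLocalization.mk' (Localization M) P ⟨Q, hM' Q h1⟩
  let w := IsLocalization.mk' (Localization M) P' ⟨Q', hM' Q' h2⟩
  have ka : ∀ p q (hq : q ∈ M), a (IsLocalization.mk' (Localization M) p ⟨q, hq⟩) =
      algebraMap _ _ p / algebraMap _ _ q := fun p q hq => by
    rw [IsLocalization.lift_mk'_spec, mul_div_cancel₀ _ (hu1 ⟨q, hq⟩).ne_zero]
  have kb : ∀ p q (hq : q ∈ M), b (IsLocalization.mk' (Localization M) p ⟨q, hq⟩) =
      p.eval t / q.eval t := fun p q hq => by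
    rw [IsLocalization.lift_mk'_spec]
    exact (mul_div_cancel₀ _ (hM q hq)).symm
  have h3 : G.eval₂ (aeval w : ℝ[X] →ₐ[ℝ] Localization M).toRingHom u = 0 := by
    apply ha
    rw [hom_eval₂, map_zero, ← hG, ← ka P Q (hM' Q h1)]
    congr 1
    refine ringHom_ext (fun r => ?_) ?_
    · have h3 : algebraMap ℝ (Localization M) r = algebraMap ℝ[X] _ (C r) :=
        IsScalarTower.algebraMap_apply ℝ ℝ[X] (Localization M) r
      simp [h3, a, IsLocalization.lift_eq]
    · simpa using ka P' Q' (hM' Q' h2)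
  have h4 := congrArg b h3
  rw [hom_eval₂, map_zero] at h4
  rw [← h4, ← kb P Q (hM' Q h1)]
  congr 1
  refine ringHom_ext (fun r => ?_) ?_
  · have h5 : algebraMap ℝ (Localization M) r = algebraMap ℝ[X] _ (C r) :=
      IsScalarTower.algebraMap_apply ℝ ℝ[X] (Localization M) r
    simp [h5, b, IsLocalization.lift_eq]
  · simpa using (kb P' Q' (hM' Q' h2)).symm

/-- If an infinite rational arc `A` lies in the closure of a rational arc `B`, then both have the
same closure. A polynomial that vanishes on `A` but not on `B` satisfies, together with a coordinate
that is not constant on `A`, an algebraic relation on `B`; on `A` this relation would leave only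
finitely many values for that coordinate. -/
lemma IsRationalArc.subset_closure_of_subset_closure [Finite ι] (hb : IsPolyBasis e)
    (he : Function.Injective fun x k => e k x) (hB : IsRationalArc e B) (hA : A.Infinite)
    (hAB : A ⊆ closure B) : B ⊆ closure A := by
  by_contra h
  obtain ⟨x, hxB, hxA⟩ := Set.not_subset.1 h
  obtain ⟨p, hpx, hpA⟩ := hb.exists_of_notMem isClosed_closure hxA
  obtain ⟨k, hk⟩ : ∃ k, (e k '' A).Infinite := by
    by_contra! hk
    refine hA (Set.Finite.of_finite_image (f := fun x k => e k x) ?_ he.injOn)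
    refine (Set.Finite.pi' hk).subset ?_
    rintro _ ⟨y, hy, rfl⟩ j
    exact ⟨y, hy, rfl⟩
  obtain ⟨θ, hθ⟩ := hB
  obtain ⟨P, Q, hPQ⟩ := RationalOn.eval hθ p
  obtain ⟨P', Q', hPQ'⟩ := hθ k
  have hP : P ≠ 0 := fun h0 => hpx (by simp [(hPQ x hxB).2, h0])
  have hQ : Q ≠ 0 := fun h0 => (hPQ x hxB).1 (by simp [h0])
  obtain ⟨G, hG0, hG⟩ := exists_eval_relation P Q P' Q' hP hQ
  let q : MvPolynomial ι ℝ := G.eval₂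
    (aeval (MvPolynomial.X k) : ℝ[X] →ₐ[ℝ] MvPolynomial ι ℝ).toRingHom p
  have hq : ∀ y, MvPolynomial.eval (fun k => e k y) q =
      G.eval₂ (evalRingHom (e k y)) (MvPolynomial.eval (fun k => e k y) p) := by
    intro y
    rw [hom_eval₂]
    congr 1
    refine ringHom_ext (fun r => ?_) ?_ <;> simp [MvPolynomial.algebraMap_eq]
  have hqB : closure B ⊆ {y | MvPolynomial.eval (fun k => e k y) q = 0} := by
    refine closure_minimal (fun y hy => ?_) (hb.isClosed_zeros q)
    have h1 : MvPolynomial.eval (fun k => e k y) p = _ := (hPQ y hy).2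
    rw [Set.mem_ofPred_eq, hq, h1, (hPQ' y hy).2]
    exact hG _ (hPQ y hy).1 (hPQ' y hy).1
  refine hk ((G.coeff 0).roots.toFinset.finite_toSet.subset ?_)
  rintro _ ⟨y, hy, rfl⟩
  have h1 : MvPolynomial.eval (fun k => e k y) q = 0 := hqB (hAB hy)
  rw [hq, hpA y (subset_closure hy), eval₂_at_zero] at h1
  simpa [hG0] using h1

/-- In a space covered by finitely many rational arcs, the irreducible closed sets are the points
and the closures of arcs. -/
lemma IsIrreducible.eq_singleton_or_eq_closure_arc (hb : IsPolyBasis e)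
    (he : Function.Injective fun x k => e k x) {S : Set (Set X)} (hS : S.Finite)
    (hcov : ⋃₀ S = Set.univ) (harc : ∀ A ∈ S, IsRationalArc e A) {Z : Set X}
    (hZ : IsIrreducible Z) (hZc : IsClosed Z) :
    (∃ x, Z = {x}) ∨ ∃ A ∈ S, A.Infinite ∧ Z = closure A := by
  classical
  have := hb.t1Space he
  have h1 := isIrreducible_iff_sUnion_isClosed.1 hZ (hS.toFinset.image fun A => closure (A ∩ Z))
    (by simp) (fun x hx => by
      obtain ⟨A, hA, hxA⟩ : x ∈ ⋃₀ S := hcov ▸ Set.mem_univ x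
      exact ⟨closure (A ∩ Z), by simpa using ⟨A, hA, rfl⟩, subset_closure ⟨hxA, hx⟩⟩)
  obtain ⟨z, hz, hZz⟩ := h1
  obtain ⟨A, hA, rfl⟩ := Finset.mem_image.1 hz
  rw [Set.Finite.mem_toFinset] at hA
  have hfin : Z.Finite → ∃ x, Z = {x} := fun hf => by
    obtain ⟨x, hx⟩ := hZ.nonempty
    refine ⟨x, ?_⟩
    have h2 := isIrreducible_iff_sUnion_isClosed.1 hZ (hf.toFinset.image fun x => {x})
      (by simp) (fun x hx => ⟨{x}, by simpa using hx, rfl⟩)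
    obtain ⟨w, hw, hZw⟩ := h2
    obtain ⟨y, -, rfl⟩ := Finset.mem_image.1 hw
    obtain rfl : x = y := hZw hx
    exact Set.Subset.antisymm hZw (Set.singleton_subset_iff.2 hx)
  rcases (harc A hA).subset_or_finite hb he hZc with h3 | h3
  · have hZA : Z = closure A := by
      rw [Set.inter_eq_left.2 h3] at hZz
      exact Set.Subset.antisymm hZz (closure_minimal h3 hZc)
    by_cases hf : Z.Finite
    · exact Or.inl (hfin hf)
    · exact Or.inr ⟨A, hA, fun hAf => hf (by rwa [hZA, hAf.isClosed.closure_eq]), hZA⟩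
  · exact Or.inl (hfin (h3.subset (by rwa [h3.isClosed.closure_eq] at hZz)))

/-- In a space covered by finitely many rational arcs, the closure of an infinite rational arc is an
irreducible component. -/
lemma IsRationalArc.closure_mem_irreducibleComponents [Finite ι] (hb : IsPolyBasis e)
    (he : Function.Injective fun x k => e k x) {S : Set (Set X)} (hS : S.Finite)
    (hcov : ⋃₀ S = Set.univ) (harc : ∀ A ∈ S, IsRationalArc e A) {M : Set X}
    (hM : IsRationalArc e M) (hinf : M.Infinite) : closure M ∈ irreducibleComponents X := by
  refine ⟨(hM.isIrreducible hb he hinf).closure, fun Z hZ hMZ => ?_⟩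
  have hM' : M ⊆ closure Z := subset_closure.trans (hMZ.trans subset_closure)
  rcases IsIrreducible.eq_singleton_or_eq_closure_arc hb he hS hcov harc hZ.closure
    isClosed_closure with ⟨x, hx⟩ | ⟨A, hA, -, hZA⟩
  · exact absurd ((Set.finite_singleton x).subset (hx ▸ hM')) hinf
  · have h1 := (harc A hA).subset_closure_of_subset_closure hb he hinf (hZA ▸ hM')
    exact subset_closure.trans (hZA ▸ closure_minimal h1 isClosed_closure)

/-- A space covered by finitely many rational arcs, one of them infinite, has dimension one. -/
lemma topologicalKrullDim_eq_one_of_arcs [Finite ι] (hb : IsPolyBasis e)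
    (he : Function.Injective fun x k => e k x) {S : Set (Set X)} (hS : S.Finite)
    (hcov : ⋃₀ S = Set.univ) (harc : ∀ A ∈ S, IsRationalArc e A) {M : Set X}
    (hM : IsRationalArc e M) (hinf : M.Infinite) : topologicalKrullDim X = 1 := by
  have := hb.t1Space he
  have hcl : ∀ Z : TopologicalSpace.IrreducibleCloseds X,
      (∃ x, (Z : Set X) = {x}) ∨ ∃ A ∈ S, A.Infinite ∧ (Z : Set X) = closure A := fun Z =>
    IsIrreducible.eq_singleton_or_eq_closure_arc hb he hS hcov harc Z.isIrreducible Z.isClosed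
  apply le_antisymm
  · refine Order.krullDim_le_one_iff.2 fun Z => ?_
    rcases hcl Z with ⟨x, hx⟩ | ⟨A, hA, hAinf, hZA⟩
    · refine Or.inl fun Y hY => ?_
      have h1 : (Y : Set X) ⊆ {x} := hx ▸ hY
      have h2 : (Y : Set X) = {x} := h1.antisymm
        (Set.singleton_subset_iff.2 (by
          obtain ⟨y, hy⟩ := Y.isIrreducible.nonempty
          obtain rfl : y = x := h1 hy
          exact hy))
      exact (hx.trans h2.symm).le
    · refine Or.inr fun Y hY => ?_
      have hAY : A ⊆ Y := subset_closure.trans (hZA ▸ hY)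
      rcases hcl Y with ⟨x, hx⟩ | ⟨B, hB, -, hYB⟩
      · exact absurd ((Set.finite_singleton x).subset (hx ▸ hAY)) hAinf
      · have h1 := (harc B hB).subset_closure_of_subset_closure hb he hAinf (hYB ▸ hAY)
        change (Y : Set X) ⊆ Z
        rw [hYB, hZA]
        exact closure_minimal h1 isClosed_closure
  · refine Order.one_le_krullDim_iff.2 ?_
    obtain ⟨x, hx⟩ := hinf.nonempty
    refine ⟨⟨{x}, isIrreducible_singleton, isClosed_singleton⟩,
      ⟨closure M, (hM.isIrreducible hb he hinf).closure, isClosed_closure⟩, ?_⟩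
    refine lt_of_le_of_ne (Set.singleton_subset_iff.2 (subset_closure hx)) fun h => ?_
    have h1 : ({x} : Set X) = closure M := congrArg SetLike.coe h
    exact hinf ((Set.finite_singleton x).subset (h1 ▸ subset_closure))

end Arcs

/-! ### From homogeneous to affine coordinates -/

lemma MvPolynomial.eval_scale {V D : Type*} [Fintype D] [DecidableEq D] (π : V → D) (m : D → ℕ)
    (p : MvPolynomial V ℝ)
    (hp : ∀ d, p.IsWeightedHomogeneous (fun v => if π v = d then 1 else 0) (m d))
    (c : D → ℝ) (y : V → ℝ) :
    MvPolynomial.eval (fun v => c (π v) * y v) p = (∏ d, c d ^ m d) * MvPolynomial.eval y p := by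
  rw [MvPolynomial.eval_eq, MvPolynomial.eval_eq, Finset.mul_sum]
  refine Finset.sum_congr rfl fun s hs => ?_
  have h1 : ∏ d, c d ^ m d = ∏ i ∈ s.support, c (π i) ^ s i := by
    have h2 : ∀ d, c d ^ m d = ∏ i ∈ s.support, if π i = d then c d ^ s i else 1 := by
      intro d
      rw [← hp d (MvPolynomial.mem_support_iff.1 hs), Finsupp.weight_apply, Finsupp.sum,
        ← Finset.prod_pow_eq_pow_sum]
      refine Finset.prod_congr rfl fun i _ => ?_
      split_ifs <;> simp
    rw [Finset.prod_congr rfl fun d _ => h2 d, Finset.prod_comm]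
    refine Finset.prod_congr rfl fun i _ => ?_
    simp
  simp only [mul_pow, Finset.prod_mul_distrib]
  rw [h1]
  ring

/-- A topology generated by non-vanishing loci of multihomogeneous polynomials in homogeneous
coordinates (grouped into blocks by `π`) is the Zariski topology of affine coordinates `e k`,
provided that the `e k` are quotients of multihomogeneous polynomials of degree two in each block,
with a common denominator `N`, and that homogeneous coordinates can be recovered from the `e k` by
polynomial charts, each valid where its scaling factors do not vanish. -/
lemma isPolyBasis_of_homogeneous {X V D ι χ : Type*} [Fintype D] [DecidableEq D]
    [τ : TopologicalSpace X] (π : V → D) (Has : (V → ℝ) → X → Prop) (e : ι → X → ℝ)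
    (hτ : τ = TopologicalSpace.generateFrom {U | ∃ (m : D → ℕ) (p : MvPolynomial V ℝ),
      (∀ d, p.IsWeightedHomogeneous (fun v => if π v = d then 1 else 0) (m d)) ∧
      U = {x | ∃ y, Has y x ∧ MvPolynomial.eval y p ≠ 0}})
    (N : MvPolynomial V ℝ)
    (hN : ∀ d, N.IsWeightedHomogeneous (fun v => if π v = d then 1 else 0) 2)
    (num : ι → MvPolynomial V ℝ)
    (hnum : ∀ k d, (num k).IsWeightedHomogeneous (fun v => if π v = d then 1 else 0) 2)
    (hex : ∀ x, ∃ y, Has y x)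
    (hN0 : ∀ x y, Has y x → MvPolynomial.eval y N ≠ 0)
    (hev : ∀ k x y, Has y x → MvPolynomial.eval y (num k) = e k x * MvPolynomial.eval y N)
    (chart : χ → V → MvPolynomial ι ℝ)
    (hchart : ∀ x y, Has y x → ∀ a, ∃ c : D → ℝ,
      ∀ v, MvPolynomial.eval (fun k => e k x) (chart a v) = c (π v) * y v)
    (hvalid : ∀ x y, Has y x → ∃ a, ∃ c : D → ℝ, (∀ d, c d ≠ 0) ∧
      ∀ v, MvPolynomial.eval (fun k => e k x) (chart a v) = c (π v) * y v) :
    IsPolyBasis e := by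
  have hhom : ∀ p : MvPolynomial ι ℝ, ∃ (m : ℕ) (q : MvPolynomial V ℝ),
      (∀ d, q.IsWeightedHomogeneous (fun v => if π v = d then 1 else 0) (2 * m)) ∧
      ∀ x y, Has y x → MvPolynomial.eval y q =
        MvPolynomial.eval (fun k => e k x) p * MvPolynomial.eval y N ^ m := by
    intro p
    induction p using MvPolynomial.induction_on with
    | C a =>
      exact ⟨0, MvPolynomial.C a, fun d => MvPolynomial.isWeightedHomogeneous_C _ _,
        fun x y _ => by simp⟩
    | add p p' hp hp' =>
      obtain ⟨m, q, hq, hpq⟩ := hp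
      obtain ⟨m', q', hq', hpq'⟩ := hp'
      refine ⟨m + m', q * N ^ m' + q' * N ^ m, fun d => ?_, fun x y h => ?_⟩
      · have h1 := (hq d).mul ((hN d).pow m')
        have h2 := (hq' d).mul ((hN d).pow m)
        refine MvPolynomial.IsWeightedHomogeneous.add ?_ ?_
        · convert h1 using 1; simp; ring
        · convert h2 using 1; simp; ring
      · simp only [map_add, map_mul, map_pow, hpq x y h, hpq' x y h]
        ring
    | mul_X p k hp =>
      obtain ⟨m, q, hq, hpq⟩ := hp
      refine ⟨m + 1, q * num k, fun d => (hq d).mul (hnum k d), fun x y h => ?_⟩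
      simp only [map_mul, hpq x y h, hev k x y h, MvPolynomial.eval_X]
      ring
  have hopen : ∀ p : MvPolynomial ι ℝ,
      IsOpen {x | MvPolynomial.eval (fun k => e k x) p ≠ 0} := by
    intro p
    obtain ⟨m, q, hq, hpq⟩ := hhom p
    rw [hτ]
    refine TopologicalSpace.isOpen_generateFrom_of_mem ⟨fun _ => 2 * m, q, hq, ?_⟩
    ext x
    simp only [Set.mem_ofPred_eq]
    constructor
    · intro h
      obtain ⟨y, hy⟩ := hex x
      exact ⟨y, hy, by rw [hpq x y hy]; exact mul_ne_zero h (pow_ne_zero _ (hN0 x y hy))⟩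
    · rintro ⟨y, hy, h⟩ h0
      exact h (by rw [hpq x y hy, h0, zero_mul])
  refine ⟨?_, ?_, le_antisymm ?_ ?_⟩
  · rintro _ ⟨p, rfl⟩ _ ⟨q, rfl⟩ x ⟨hp, hq⟩
    refine ⟨_, ⟨p * q, rfl⟩, ?_, fun y hy => ?_⟩
    · simpa using ⟨hp, hq⟩
    · simpa using hy
  · exact Set.eq_univ_of_univ_subset (Set.subset_sUnion_of_mem ⟨1, by simp⟩)
  · refine le_generateFrom ?_
    rintro _ ⟨p, rfl⟩
    exact hopen p
  · conv_rhs => rw [hτ]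
    refine le_generateFrom ?_
    rintro _ ⟨m, p, hp, rfl⟩
    have hcomp : ∀ q a x,
        MvPolynomial.eval (fun k => e k x) (MvPolynomial.aeval (chart a) q) =
          MvPolynomial.eval (fun v => MvPolynomial.eval (fun k => e k x) (chart a v)) q := by
      intro q a x
      induction q using MvPolynomial.induction_on with
      | C r => simp [MvPolynomial.algebraMap_eq]
      | add q q' hq hq' => simp only [map_add, hq, hq']
      | mul_X q v hq => simp only [map_mul, hq, MvPolynomial.aeval_X, MvPolynomial.eval_X]
    have : {x | ∃ y, Has y x ∧ MvPolynomial.eval y p ≠ 0} =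
        ⋃ a : χ, {x | MvPolynomial.eval (fun k => e k x) (MvPolynomial.aeval (chart a) p) ≠ 0} := by
      ext x
      simp only [Set.mem_ofPred_eq, Set.mem_iUnion, hcomp]
      constructor
      · rintro ⟨y, hy, h⟩
        obtain ⟨a, c, hc, hac⟩ := hvalid x y hy
        refine ⟨a, ?_⟩
        rw [funext hac, MvPolynomial.eval_scale π m p hp]
        exact mul_ne_zero (Finset.prod_ne_zero_iff.2 fun d _ => pow_ne_zero _ (hc d)) h
      · rintro ⟨a, h⟩
        obtain ⟨y, hy⟩ := hex x
        obtain ⟨c, hac⟩ := hchart x y hy a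
        refine ⟨y, hy, fun h0 => h ?_⟩
        rw [funext hac, MvPolynomial.eval_scale π m p hp, h0, mul_zero]
    rw [this]
    exact @isOpen_iUnion _ _ (_) _ fun a =>
      TopologicalSpace.isOpen_generateFrom_of_mem ⟨_, rfl⟩

lemma IsPolyBasis.subtype {X ι : Type*} [TopologicalSpace X] {e : ι → X → ℝ} (hb : IsPolyBasis e)
    (R : Set X) : IsPolyBasis fun k (x : R) => e k x := by
  have h := hb.isInducing (f := ((↑) : R → X)) Topology.IsInducing.subtypeVal
  unfold IsPolyBasis
  convert h using 1
  ext U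
  constructor
  · rintro ⟨p, rfl⟩
    exact ⟨_, ⟨p, rfl⟩, rfl⟩
  · rintro ⟨_, ⟨p, rfl⟩, rfl⟩
    exact ⟨p, rfl⟩

/-! ### The group of direct isometries -/

namespace SE2

open ComplexConjugate

/-- The linear part of a direct isometry, as a complex number of modulus one. -/
noncomputable def lin (σ : SE2) : ℂ := (σ : ℂ ≃ᵃⁱ[ℝ] ℂ) 1 - (σ : ℂ ≃ᵃⁱ[ℝ] ℂ) 0

/-- The translation part of a direct isometry: the image of the origin. -/
noncomputable def tr (σ : SE2) : ℂ := (σ : ℂ ≃ᵃⁱ[ℝ] ℂ) 0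

lemma apply_eq_and_norm (σ : SE2) :
    (∀ u, (σ : ℂ ≃ᵃⁱ[ℝ] ℂ) u = lin σ * u + tr σ) ∧ ‖lin σ‖ = 1 := by
  have h : ∀ u, (σ : ℂ ≃ᵃⁱ[ℝ] ℂ) u = (σ : ℂ ≃ᵃⁱ[ℝ] ℂ).linearIsometryEquiv u + tr σ := by
    intro u
    simpa [tr] using (σ : ℂ ≃ᵃⁱ[ℝ] ℂ).map_vadd 0 u
  have hdet : LinearMap.det
      ((σ : ℂ ≃ᵃⁱ[ℝ] ℂ).linearIsometryEquiv.toLinearEquiv : ℂ →ₗ[ℝ] ℂ) = 1 := σ.2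
  obtain ⟨a, ha | ha⟩ := linear_isometry_complex (σ : ℂ ≃ᵃⁱ[ℝ] ℂ).linearIsometryEquiv
  · have hlin : lin σ = a := by
      rw [lin, h 1, tr, add_sub_cancel_right, ha, rotation_apply, mul_one]
    refine ⟨fun u => ?_, by rw [hlin]; exact a.norm_coe⟩
    rw [h, ha, rotation_apply, hlin]
  · rw [ha] at hdet
    have h1 := LinearMap.det_comp ((rotation a).toLinearEquiv : ℂ →ₗ[ℝ] ℂ)
      (Complex.conjLIE.toLinearEquiv : ℂ →ₗ[ℝ] ℂ)
    rw [det_rotation, Complex.det_conjLIE] at h1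
    have h2 := hdet.symm.trans h1
    norm_num at h2

lemma apply_eq (σ : SE2) (u : ℂ) : (σ : ℂ ≃ᵃⁱ[ℝ] ℂ) u = lin σ * u + tr σ :=
  (apply_eq_and_norm σ).1 u

lemma lin_mul_conj (σ : SE2) : lin σ * conj (lin σ) = 1 := by
  rw [Complex.mul_conj, Complex.normSq_eq_norm_sq, (apply_eq_and_norm σ).2]
  simp

lemma lin_ne_zero (σ : SE2) : lin σ ≠ 0 := left_ne_zero_of_mul ((lin_mul_conj σ).symm ▸ one_ne_zero)

lemma ext_lin_tr {σ τ : SE2} (h1 : lin σ = lin τ) (h2 : tr σ = tr τ) : σ = τ := by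
  refine Subtype.ext (AffineIsometryEquiv.ext fun u => ?_)
  rw [apply_eq, apply_eq, h1, h2]

lemma coe_mul_apply (σ τ : SE2) (u : ℂ) :
    ((σ * τ : SE2) : ℂ ≃ᵃⁱ[ℝ] ℂ) u = (σ : ℂ ≃ᵃⁱ[ℝ] ℂ) ((τ : ℂ ≃ᵃⁱ[ℝ] ℂ) u) := rfl

lemma tr_mul (σ τ : SE2) : tr (σ * τ) = lin σ * tr τ + tr σ := by
  rw [tr, coe_mul_apply, apply_eq]; rfl

lemma lin_mul (σ τ : SE2) : lin (σ * τ) = lin σ * lin τ := by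
  rw [lin, coe_mul_apply, coe_mul_apply, apply_eq σ, apply_eq σ, apply_eq τ, apply_eq τ]
  ring

@[simp] lemma lin_one : lin 1 = 1 := by
  change (1 : ℂ) - 0 = 1
  simp

@[simp] lemma tr_one : tr 1 = 0 := rfl

lemma lin_inv (σ : SE2) : lin σ⁻¹ = conj (lin σ) := by
  have h := lin_mul σ σ⁻¹
  rw [mul_inv_cancel, lin_one, ← lin_mul_conj σ] at h
  exact (mul_left_cancel₀ (lin_ne_zero σ) h).symm

/-- The direct isometry `u ↦ a u + b`. -/
noncomputable def ofLinTr (a : Circle) (b : ℂ) : SE2 :=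
  ⟨(rotation a).toAffineIsometryEquiv.trans (AffineIsometryEquiv.constVAdd ℝ ℂ b),
    det_rotation a⟩

lemma ofLinTr_apply (a : Circle) (b u : ℂ) : (ofLinTr a b : ℂ ≃ᵃⁱ[ℝ] ℂ) u = a * u + b := by
  change b + rotation a u = a * u + b
  rw [rotation_apply, add_comm]

@[simp] lemma lin_ofLinTr (a : Circle) (b : ℂ) : lin (ofLinTr a b) = a := by
  simp [lin, ofLinTr_apply]

@[simp] lemma tr_ofLinTr (a : Circle) (b : ℂ) : tr (ofLinTr a b) = b := by
  simp [tr, ofLinTr_apply]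

lemma mem_rotations_iff {c : ℂ} {σ : SE2} : σ ∈ rotations c ↔ tr σ = c - lin σ * c := by
  change (σ : ℂ ≃ᵃⁱ[ℝ] ℂ) c = c ↔ _
  rw [apply_eq, eq_sub_iff_add_eq, add_comm]

lemma ofReal_sq_add_sq (x y : ℝ) : ((x ^ 2 + y ^ 2 : ℝ) : ℂ) = ⟨x, y⟩ * conj (⟨x, y⟩ : ℂ) := by
  rw [Complex.mul_conj, Complex.normSq_mk, pow_two, pow_two]

lemma hasCoords_iff {x : Fin 4 → ℝ} {σ : SE2} : HasCoords x σ ↔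
    x 0 ^ 2 + x 1 ^ 2 ≠ 0 ∧ lin σ * (x 0 ^ 2 + x 1 ^ 2 : ℝ) = (⟨x 0, x 1⟩ : ℂ) ^ 2 ∧
      tr σ * (x 0 ^ 2 + x 1 ^ 2 : ℝ) = (⟨x 0, x 1⟩ : ℂ) * ⟨x 2, x 3⟩ := by
  refine and_congr_right fun hN => ?_
  have hN' : ((x 0 ^ 2 + x 1 ^ 2 : ℝ) : ℂ) ≠ 0 := Complex.ofReal_ne_zero.2 hN
  simp only [apply_eq, eq_div_iff hN']
  constructor
  · intro h
    have h0 := h 0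
    have h1 := h 1
    simp only [mul_zero, zero_add, zero_mul, mul_one, one_mul] at h0 h1
    exact ⟨by rw [add_mul, h0] at h1; exact add_right_cancel h1, h0⟩
  · rintro ⟨h1, h2⟩ u
    rw [add_mul, h2, mul_right_comm, h1, mul_comm]

/-- The real affine coordinates of a direct isometry: real and imaginary parts of its linear part
and of its translation part. -/
noncomputable def coord : Fin 4 → SE2 → ℝ :=
  ![fun σ => (lin σ).re, fun σ => (lin σ).im, fun σ => (tr σ).re, fun σ => (tr σ).im]

lemma coord_injective : Function.Injective fun (σ : SE2) k => coord k σ := by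
  intro σ τ h
  exact ext_lin_tr (Complex.ext (congrFun h 0) (congrFun h 1))
    (Complex.ext (congrFun h 2) (congrFun h 3))

lemma coord_of_hasCoords {x : Fin 4 → ℝ} {σ : SE2} (h : HasCoords x σ) :
    (x 0 ^ 2 + x 1 ^ 2 ≠ 0) ∧
    coord 0 σ * (x 0 ^ 2 + x 1 ^ 2) = x 0 ^ 2 - x 1 ^ 2 ∧
    coord 1 σ * (x 0 ^ 2 + x 1 ^ 2) = 2 * (x 0 * x 1) ∧
    coord 2 σ * (x 0 ^ 2 + x 1 ^ 2) = x 0 * x 2 - x 1 * x 3 ∧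
    coord 3 σ * (x 0 ^ 2 + x 1 ^ 2) = x 0 * x 3 + x 1 * x 2 := by
  obtain ⟨hN, h1, h2⟩ := hasCoords_iff.1 h
  have e1 := congrArg Complex.re h1
  have e2 := congrArg Complex.im h1
  have e3 := congrArg Complex.re h2
  have e4 := congrArg Complex.im h2
  rw [Complex.re_mul_ofReal] at e1 e3
  rw [Complex.im_mul_ofReal] at e2 e4
  simp only [pow_two, Complex.mul_re, Complex.mul_im] at e1 e2 e3 e4
  refine ⟨hN, ?_, ?_, ?_, ?_⟩
  · change (lin σ).re * _ = _; rw [pow_two, pow_two, e1]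
  · change (lin σ).im * _ = _; rw [pow_two, pow_two, e2]; ring
  · change (tr σ).re * _ = _; rw [pow_two, pow_two, e3]
  · change (tr σ).im * _ = _; rw [pow_two, pow_two, e4]

/-- A complex number `z ≠ 0` whose square has the direction of a given number of modulus one. -/
lemma exists_sq_direction {a : ℂ} (ha : a * conj a = 1) :
    ∃ x y : ℝ, x ^ 2 + y ^ 2 ≠ 0 ∧ a * (x ^ 2 + y ^ 2 : ℝ) = (⟨x, y⟩ : ℂ) ^ 2 := by
  by_cases h : 1 + a = 0
  · refine ⟨0, 1, by norm_num, ?_⟩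
    rw [eq_neg_of_add_eq_zero_right h]
    norm_num
    exact Complex.I_sq.symm
  · refine ⟨(1 + a).re, (1 + a).im, ?_, ?_⟩
    · rw [pow_two, pow_two, ← Complex.normSq_apply]
      exact fun h0 => h (Complex.normSq_eq_zero.1 h0)
    · rw [ofReal_sq_add_sq, Complex.eta, map_add, map_one]
      linear_combination (1 + a) * ha

lemma exists_hasCoords (σ : SE2) : ∃ x, HasCoords x σ := by
  obtain ⟨x, y, h0, h1⟩ := exists_sq_direction (lin_mul_conj σ)
  let w := tr σ * conj (⟨x, y⟩ : ℂ)
  refine ⟨![x, y, w.re, w.im], hasCoords_iff.2 ⟨h0, h1, ?_⟩⟩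
  change tr σ * (x ^ 2 + y ^ 2 : ℝ) = ⟨x, y⟩ * w
  rw [ofReal_sq_add_sq]
  simp only [w]
  ring

/-- Homogeneous coordinates in terms of the affine ones, valid for rotation angles other than `π`:
`z` has the direction of `1 + a`, where `a` is the linear part. -/
noncomputable def chart₀ : Fin 4 → MvPolynomial (Fin 4) ℝ :=
  ![1 + MvPolynomial.X 0, MvPolynomial.X 1,
    MvPolynomial.X 2 * (1 + MvPolynomial.X 0) + MvPolynomial.X 3 * MvPolynomial.X 1,
    MvPolynomial.X 3 * (1 + MvPolynomial.X 0) - MvPolynomial.X 2 * MvPolynomial.X 1]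

/-- Homogeneous coordinates in terms of the affine ones, valid for non-zero rotation angles: `z` has
the direction of `i (1 - a)`, where `a` is the linear part. -/
noncomputable def chart₁ : Fin 4 → MvPolynomial (Fin 4) ℝ :=
  ![MvPolynomial.X 1, 1 - MvPolynomial.X 0,
    MvPolynomial.X 2 * MvPolynomial.X 1 + MvPolynomial.X 3 * (1 - MvPolynomial.X 0),
    MvPolynomial.X 3 * MvPolynomial.X 1 - MvPolynomial.X 2 * (1 - MvPolynomial.X 0)]

lemma eval_chart {x : Fin 4 → ℝ} {σ : SE2} (h : HasCoords x σ) :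
    (∀ v, MvPolynomial.eval (fun k => coord k σ) (chart₀ v) =
      2 * x 0 / (x 0 ^ 2 + x 1 ^ 2) * x v) ∧
    ∀ v, MvPolynomial.eval (fun k => coord k σ) (chart₁ v) =
      2 * x 1 / (x 0 ^ 2 + x 1 ^ 2) * x v := by
  obtain ⟨hN, h0, h1, h2, h3⟩ := coord_of_hasCoords h
  rw [← eq_div_iff hN] at h0 h1 h2 h3
  constructor <;> intro v <;> fin_cases v <;>
    simp [chart₀, chart₁, h0, h1, h2, h3] <;> field_simp <;> ring

lemma isPolyBasis_coord : IsPolyBasis coord := by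
  have hw : ∀ d : Unit, (fun _ : Fin 4 => if () = d then 1 else 0) = (1 : Fin 4 → ℕ) := fun d => by
    ext; simp
  have hX : ∀ i j : Fin 4, (MvPolynomial.X i * MvPolynomial.X j :
      MvPolynomial (Fin 4) ℝ).IsHomogeneous 2 := fun i j =>
    (MvPolynomial.isHomogeneous_X _ i).mul (MvPolynomial.isHomogeneous_X _ j)
  refine isPolyBasis_of_homogeneous (V := Fin 4) (D := Unit) (χ := Bool) (fun _ => ()) HasCoords
    coord ?_ (MvPolynomial.X 0 ^ 2 + MvPolynomial.X 1 ^ 2) ?_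
    ![MvPolynomial.X 0 ^ 2 - MvPolynomial.X 1 ^ 2,
      MvPolynomial.C 2 * (MvPolynomial.X 0 * MvPolynomial.X 1),
      MvPolynomial.X 0 * MvPolynomial.X 2 - MvPolynomial.X 1 * MvPolynomial.X 3,
      MvPolynomial.X 0 * MvPolynomial.X 3 + MvPolynomial.X 1 * MvPolynomial.X 2] ?_
    exists_hasCoords ?_ ?_
    (fun b => bif b then chart₁ else chart₀) ?_ ?_
  · refine congrArg TopologicalSpace.generateFrom (Set.ext fun U => ⟨?_, ?_⟩)
    · rintro ⟨m, p, hp, rfl⟩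
      exact ⟨fun _ => m, p, fun d => (hw d).symm ▸ hp, rfl⟩
    · rintro ⟨m, p, hp, rfl⟩
      exact ⟨m (), p, by have h := hp (); rwa [hw] at h, rfl⟩
  · intro d
    rw [hw, pow_two, pow_two]
    exact (hX 0 0).add (hX 1 1)
  · intro k d
    rw [hw]
    fin_cases k
    · simp only [pow_two]
      exact (hX 0 0).sub (hX 1 1)
    · have h := (MvPolynomial.isHomogeneous_C (Fin 4) (2 : ℝ)).mul (hX 0 1)
      rwa [zero_add] at h
    · exact (hX 0 2).sub (hX 1 3)
    · exact (hX 0 3).add (hX 1 2)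
  · intro σ x h
    simpa using h.1
  · intro k σ x h
    obtain ⟨-, h0, h1, h2, h3⟩ := coord_of_hasCoords h
    fin_cases k <;> simp [h0, h1, h2, h3]
  · intro σ x h b
    cases b
    exacts [⟨fun _ => 2 * x 0 / (x 0 ^ 2 + x 1 ^ 2), (eval_chart h).1⟩,
      ⟨fun _ => 2 * x 1 / (x 0 ^ 2 + x 1 ^ 2), (eval_chart h).2⟩]
  · intro σ x h
    by_cases h0 : x 0 = 0
    · refine ⟨true, fun _ => 2 * x 1 / (x 0 ^ 2 + x 1 ^ 2), fun _ => ?_, (eval_chart h).2⟩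
      refine div_ne_zero (mul_ne_zero two_ne_zero fun h1 => h.1 ?_) h.1
      rw [h0, h1]; norm_num
    · exact ⟨false, fun _ => 2 * x 0 / (x 0 ^ 2 + x 1 ^ 2), fun _ => div_ne_zero (mul_ne_zero two_ne_zero h0) h.1, (eval_chart h).1⟩

end SE2

/-! ### Configuration spaces -/

namespace Linkage

open ComplexConjugate

variable {L : Linkage}

/-- The real affine coordinates of a configuration: real and imaginary parts of the linear parts of
all its rotations. -/
noncomputable def configCoord (L : Linkage) (v : L.graph.Dart × Fin 2) (S : L.Configuration) : ℝ :=
  (![(SE2.lin (S.pos v.1)).re, (SE2.lin (S.pos v.1)).im] : Fin 2 → ℝ) v.2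

lemma tr_pos (S : L.Configuration) (d : L.graph.Dart) :
    SE2.tr (S.pos d) = L.dartCenter d - SE2.lin (S.pos d) * L.dartCenter d :=
  SE2.mem_rotations_iff.1 (S.pos_mem d)

lemma config_ext {S T : L.Configuration} (h : ∀ d, SE2.lin (S.pos d) = SE2.lin (T.pos d)) :
    S = T := by
  refine Configuration.ext (funext fun d => SE2.ext_lin_tr (h d) ?_)
  rw [tr_pos, tr_pos, h]

lemma configCoord_injective : Function.Injective fun (S : L.Configuration) v => configCoord L v S := by
  intro S T h
  exact config_ext fun d => Complex.ext (congrFun h (d, 0)) (congrFun h (d, 1))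

lemma _root_.SE2.hasCoords_rotationCoords_iff {c : ℂ} {σ : SE2} (hσ : σ ∈ SE2.rotations c)
    {y : Fin 2 → ℝ} : SE2.HasCoords (SE2.rotationCoords c y) σ ↔
      y 0 ^ 2 + y 1 ^ 2 ≠ 0 ∧ SE2.lin σ * (y 0 ^ 2 + y 1 ^ 2 : ℝ) = (⟨y 0, y 1⟩ : ℂ) ^ 2 := by
  rw [SE2.hasCoords_iff, SE2.mem_rotations_iff.1 hσ]
  change _ ∧ _ ∧ _ * ((y 0 ^ 2 + y 1 ^ 2 : ℝ) : ℂ) =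
    (⟨y 0, y 1⟩ : ℂ) * ⟨2 * c.im * y 1, -2 * c.re * y 1⟩ ↔ _
  refine and_congr_right fun _ => and_iff_left_of_imp fun h => ?_
  change SE2.lin σ * ((y 0 ^ 2 + y 1 ^ 2 : ℝ) : ℂ) = (⟨y 0, y 1⟩ : ℂ) ^ 2 at h
  rw [sub_mul, mul_right_comm, h]
  have h1 : (⟨2 * c.im * y 1, -2 * c.re * y 1⟩ : ℂ) =
      c * (conj (⟨y 0, y 1⟩ : ℂ) - ⟨y 0, y 1⟩) := by
    apply Complex.ext <;> simp <;> ring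
  rw [h1, SE2.ofReal_sq_add_sq]
  ring

/-- Homogeneous coordinates of a configuration, as one family of reals. -/
def HasHomCoords (L : Linkage) (y : L.graph.Dart × Fin 2 → ℝ) (S : L.Configuration) : Prop :=
  ∀ d, SE2.HasCoords (SE2.rotationCoords (L.dartCenter d) fun k => y (d, k)) (S.pos d)

lemma configCoord_of_hasHomCoords {y : L.graph.Dart × Fin 2 → ℝ} {S : L.Configuration}
    (h : L.HasHomCoords y S) (d : L.graph.Dart) : y (d, 0) ^ 2 + y (d, 1) ^ 2 ≠ 0 ∧
      configCoord L (d, 0) S * (y (d, 0) ^ 2 + y (d, 1) ^ 2) = y (d, 0) ^ 2 - y (d, 1) ^ 2 ∧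
      configCoord L (d, 1) S * (y (d, 0) ^ 2 + y (d, 1) ^ 2) = 2 * (y (d, 0) * y (d, 1)) := by
  obtain ⟨h0, h1⟩ := (SE2.hasCoords_rotationCoords_iff (S.pos_mem d)).1 (h d)
  have e1 := congrArg Complex.re h1
  have e2 := congrArg Complex.im h1
  rw [Complex.re_mul_ofReal] at e1
  rw [Complex.im_mul_ofReal] at e2
  simp only [pow_two, Complex.mul_re, Complex.mul_im] at e1 e2
  refine ⟨h0, ?_, ?_⟩
  · change (SE2.lin (S.pos d)).re * _ = _
    rw [pow_two, pow_two, e1]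
  · change (SE2.lin (S.pos d)).im * _ = _
    rw [pow_two, pow_two, e2]; ring

/-- Homogeneous coordinates of a rotation in terms of its linear part `a`: the direction of `1 + a`
(valid unless `a = -1`) for `b = false`, that of `i (1 - a)` (valid unless `a = 1`) for `b = true`. -/
noncomputable def rotationChart (L : Linkage) (b : Bool) (v : L.graph.Dart × Fin 2) :
    MvPolynomial (L.graph.Dart × Fin 2) ℝ :=
  (bif b then ![MvPolynomial.X (v.1, 1), 1 - MvPolynomial.X (v.1, 0)]
    else ![1 + MvPolynomial.X (v.1, 0), MvPolynomial.X (v.1, 1)] :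
      Fin 2 → MvPolynomial (L.graph.Dart × Fin 2) ℝ) v.2

lemma eval_rotationChart {y : L.graph.Dart × Fin 2 → ℝ} {S : L.Configuration}
    (h : L.HasHomCoords y S) (b : Bool) (v : L.graph.Dart × Fin 2) :
    MvPolynomial.eval (fun k => configCoord L k S) (rotationChart L b v) =
      2 * y (v.1, bif b then 1 else 0) / (y (v.1, 0) ^ 2 + y (v.1, 1) ^ 2) * y v := by
  obtain ⟨d, k⟩ := v
  obtain ⟨hN, h0, h1⟩ := configCoord_of_hasHomCoords h d
  rw [← eq_div_iff hN] at h0 h1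
  cases b <;> fin_cases k <;>
    simp [rotationChart, h0, h1] <;> field_simp <;> ring

lemma isWeightedHomogeneous_X_mul_X {D : Type*} [DecidableEq D] (d d' : D) (k l : Fin 2) :
    (MvPolynomial.X (d', k) * MvPolynomial.X (d', l) :
      MvPolynomial (D × Fin 2) ℝ).IsWeightedHomogeneous
        (fun v => if v.1 = d then 1 else 0) (if d' = d then 2 else 0) := by
  have h (k : Fin 2) := MvPolynomial.isWeightedHomogeneous_X ℝ
    (fun v : D × Fin 2 => if v.1 = d then (1 : ℕ) else 0) (d', k)
  have h2 : (if d' = d then 2 else 0) = (if d' = d then 1 else 0) + if d' = d then 1 else 0 := by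
    split_ifs <;> rfl
  rw [h2]
  exact (h k).mul (h l)

lemma isPolyBasis_configCoord (L : Linkage) : IsPolyBasis (configCoord L) := by
  classical
  have hX := isWeightedHomogeneous_X_mul_X (D := L.graph.Dart)
  let N : L.graph.Dart → MvPolynomial (L.graph.Dart × Fin 2) ℝ := fun d =>
    MvPolynomial.X (d, 0) ^ 2 + MvPolynomial.X (d, 1) ^ 2
  let T : L.graph.Dart × Fin 2 → MvPolynomial (L.graph.Dart × Fin 2) ℝ := fun v =>
    (![MvPolynomial.X (v.1, 0) ^ 2 - MvPolynomial.X (v.1, 1) ^ 2,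
      MvPolynomial.C 2 * (MvPolynomial.X (v.1, 0) * MvPolynomial.X (v.1, 1))] : Fin 2 → _) v.2
  have hN : ∀ d d', (N d').IsWeightedHomogeneous
      (fun v => if v.1 = d then 1 else 0) (if d' = d then 2 else 0) := fun d d' => by
    simp only [N, pow_two]
    exact (hX d d' 0 0).add (hX d d' 1 1)
  have hT : ∀ v d, (T v).IsWeightedHomogeneous
      (fun v => if v.1 = d then 1 else 0) (if v.1 = d then 2 else 0) := by
    rintro ⟨d', k⟩ d
    fin_cases k
    · simp only [T, pow_two]
      exact (MvPolynomial.weightedHomogeneousSubmodule ℝ _ _).sub_mem (hX d d' 0 0) (hX d d' 1 1)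
    · have h := (MvPolynomial.isWeightedHomogeneous_C
        (fun v : L.graph.Dart × Fin 2 => if v.1 = d then 1 else 0) (2 : ℝ)).mul (hX d d' 0 1)
      rwa [zero_add] at h
  have hNev : ∀ d y, MvPolynomial.eval y (N d) = y (d, 0) ^ 2 + y (d, 1) ^ 2 := fun d y => by
    simp [N]
  have hex : ∀ S : L.Configuration, ∃ y, L.HasHomCoords y S := by
    intro S
    choose a b h0 h1 using fun d => SE2.exists_sq_direction (SE2.lin_mul_conj (S.pos d))
    exact ⟨fun v => (![a v.1, b v.1] : Fin 2 → ℝ) v.2, fun d =>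
      (SE2.hasCoords_rotationCoords_iff (S.pos_mem d)).2 ⟨h0 d, h1 d⟩⟩
  refine isPolyBasis_of_homogeneous (χ := L.graph.Dart → Bool) Prod.fst L.HasHomCoords
    (configCoord L) ?_ (∏ d, N d) ?_ (fun v => ∏ d, if d = v.1 then T v else N d) ?_ hex ?_ ?_
    (fun b v => rotationChart L (b v.1) v) ?_ ?_
  · refine congrArg TopologicalSpace.generateFrom (Set.ext fun U => ?_)
    refine exists_congr fun m => exists_congr fun p => and_congr ?_ ?_
    · refine forall_congr' fun d => ?_
      convert Iff.rfl
    · refine Eq.congr_right (Set.ext fun S => ?_)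
      constructor
      · rintro ⟨y, hy, h⟩
        exact ⟨fun v => y v.1 v.2, hy, h⟩
      · rintro ⟨y, hy, h⟩
        exact ⟨fun d k => y (d, k), hy, h⟩
  · intro d
    have h := MvPolynomial.IsWeightedHomogeneous.prod Finset.univ N
      (fun d' => if d' = d then 2 else 0) (fun d' _ => hN d d')
    simpa using h
  · intro v d
    have h := MvPolynomial.IsWeightedHomogeneous.prod (w := fun v : L.graph.Dart × Fin 2 => if v.1 = d then 1 else 0) Finset.univ
      (fun d' => if d' = v.1 then T v else N d') (fun d' => if d' = d then 2 else 0)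
      (fun d' _ => by
        by_cases h : d' = v.1
        · simp only [h, if_true]; exact hT v d
        · simp only [h, if_false]; exact hN d d')
    simpa using h
  · intro S y h
    rw [map_prod]
    exact Finset.prod_ne_zero_iff.2 fun d _ => by
      rw [hNev]; exact (configCoord_of_hasHomCoords h d).1
  · rintro ⟨d, k⟩ S y h
    rw [map_prod, map_prod, ← Finset.mul_prod_erase _ _ (Finset.mem_univ d),
      ← Finset.mul_prod_erase _ _ (Finset.mem_univ d), ← mul_assoc]
    congr 1
    · obtain ⟨-, h0, h1⟩ := configCoord_of_hasHomCoords h d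
      rw [hNev]
      fin_cases k <;> simp [T, h0, h1]
    · refine Finset.prod_congr rfl fun d' hd' => ?_
      rw [if_neg (Finset.ne_of_mem_erase hd')]
  · intro S y h b
    exact ⟨fun d => 2 * y (d, bif b d then 1 else 0) / (y (d, 0) ^ 2 + y (d, 1) ^ 2),
      fun v => eval_rotationChart h (b v.1) v⟩
  · intro S y h
    refine ⟨fun d => decide (y (d, 0) = 0),
      fun d => 2 * y (d, bif decide (y (d, 0) = 0) then 1 else 0) /
        (y (d, 0) ^ 2 + y (d, 1) ^ 2), fun d => ?_, fun v => eval_rotationChart h _ v⟩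
    have hN := (configCoord_of_hasHomCoords h d).1
    refine div_ne_zero (mul_ne_zero two_ne_zero ?_) hN
    by_cases h0 : y (d, 0) = 0
    · simpa [h0] using hN
    · simp [h0]

end Linkage

/-! ### Covers of configuration spaces by rational arcs -/

/-- The complex-valued function `φ` is, on `A`, a rational function without poles of the real
parameter `θ`. -/
def CRationalOn {X : Type*} (A : Set X) (θ : X → ℝ) (φ : X → ℂ) : Prop :=
  RationalOn A θ (fun x => (φ x).re) ∧ RationalOn A θ fun x => (φ x).im

namespace CRationalOn

open ComplexConjugate

variable {X : Type*} {A : Set X} {θ : X → ℝ} {φ ψ : X → ℂ}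

lemma mono {B : Set X} (h : CRationalOn A θ φ) (hB : B ⊆ A) : CRationalOn B θ φ :=
  ⟨h.1.mono hB, h.2.mono hB⟩

lemma congr (h : CRationalOn A θ φ) (hψ : ∀ x ∈ A, ψ x = φ x) : CRationalOn A θ ψ :=
  ⟨h.1.congr fun x hx => by rw [hψ x hx], h.2.congr fun x hx => by rw [hψ x hx]⟩

lemma const (c : ℂ) : CRationalOn A θ fun _ => c := ⟨.const _, .const _⟩

lemma param : CRationalOn A θ fun x => (θ x : ℂ) :=
  ⟨.param, (RationalOn.const 0).congr fun _ _ => Complex.ofReal_im _⟩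

lemma add (h : CRationalOn A θ φ) (h' : CRationalOn A θ ψ) :
    CRationalOn A θ fun x => φ x + ψ x := ⟨h.1.add h'.1, h.2.add h'.2⟩

lemma neg (h : CRationalOn A θ φ) : CRationalOn A θ fun x => -φ x := ⟨h.1.neg, h.2.neg⟩

lemma sub (h : CRationalOn A θ φ) (h' : CRationalOn A θ ψ) :
    CRationalOn A θ fun x => φ x - ψ x := ⟨h.1.sub h'.1, h.2.sub h'.2⟩

lemma mul (h : CRationalOn A θ φ) (h' : CRationalOn A θ ψ) :
    CRationalOn A θ fun x => φ x * ψ x :=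
  ⟨(h.1.mul h'.1).sub (h.2.mul h'.2), (h.1.mul h'.2).add (h.2.mul h'.1)⟩

lemma conjugate (h : CRationalOn A θ φ) : CRationalOn A θ fun x => conj (φ x) := ⟨h.1, h.2.neg⟩

lemma inv (h : CRationalOn A θ φ) (h0 : ∀ x ∈ A, φ x ≠ 0) :
    CRationalOn A θ fun x => (φ x)⁻¹ := by
  have h1 : RationalOn A θ fun x => (Complex.normSq (φ x))⁻¹ :=
    RationalOn.inv ((h.1.mul h.1).add (h.2.mul h.2)) fun x hx h2 =>
      h0 x hx (Complex.normSq_eq_zero.1 h2)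
  refine ⟨(h.1.mul h1).congr fun x _ => ?_, (h.2.neg.mul h1).congr fun x _ => ?_⟩
  · rw [Complex.inv_re, div_eq_mul_inv]
  · rw [Complex.inv_im, div_eq_mul_inv]

lemma div (h : CRationalOn A θ φ) (h' : CRationalOn A θ ψ) (h0 : ∀ x ∈ A, ψ x ≠ 0) :
    CRationalOn A θ fun x => φ x / ψ x := by
  simpa only [div_eq_mul_inv] using h.mul (h'.inv h0)

end CRationalOn

/-- The space `X` is the union of finitely many sets on each of which all functions of the family
`F` are rational functions of one real parameter. -/
def HasArcCover {X : Type*} (F : Set (X → ℂ)) : Prop :=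
  ∃ S : Set (Set X), S.Finite ∧ ⋃₀ S = Set.univ ∧ ∀ A ∈ S, ∃ θ, ∀ φ ∈ F, CRationalOn A θ φ

/-- To pass from the functions `F` to the functions `F'`, every set of a cover may be cut along a
set `B`. -/
lemma HasArcCover.refine_by {X : Type*} {F F' : Set (X → ℂ)} (h : HasArcCover F) (B : Set X)
    (h₁ : ∀ A θ, A ⊆ B → (∀ φ ∈ F, CRationalOn A θ φ) → ∀ φ ∈ F', CRationalOn A θ φ)
    (h₂ : ∀ A θ, A ⊆ Bᶜ → (∀ φ ∈ F, CRationalOn A θ φ) → ∀ φ ∈ F', CRationalOn A θ φ) :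
    HasArcCover F' := by
  obtain ⟨S, hS, hcov, hF⟩ := h
  refine ⟨(fun A => A ∩ B) '' S ∪ (fun A => A ∩ Bᶜ) '' S, (hS.image _).union (hS.image _),
    Set.eq_univ_of_forall fun x => ?_, ?_⟩
  · obtain ⟨A, hA, hxA⟩ : x ∈ ⋃₀ S := hcov ▸ Set.mem_univ x
    by_cases hx : x ∈ B
    · exact ⟨A ∩ B, Or.inl ⟨A, hA, rfl⟩, hxA, hx⟩
    · exact ⟨A ∩ Bᶜ, Or.inr ⟨A, hA, rfl⟩, hxA, hx⟩
  · rintro _ (⟨A, hA, rfl⟩ | ⟨A, hA, rfl⟩) <;> obtain ⟨θ, hθ⟩ := hF A hA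
    · exact ⟨θ, h₁ _ θ Set.inter_subset_right fun φ hφ =>
        (hθ φ hφ).mono Set.inter_subset_left⟩
    · exact ⟨θ, h₂ _ θ Set.inter_subset_right fun φ hφ =>
        (hθ φ hφ).mono Set.inter_subset_left⟩

/-- The image of a rationally parametrized set is a rational arc; the parameter of a point of the
image is that of any of its preimages. -/
lemma isRationalArc_image {X Y ι : Type*} {e : ι → X → ℝ} (f : Y → X) (A : Set Y) (θ : Y → ℝ)
    (h : ∀ k, RationalOn A θ fun y => e k (f y)) : IsRationalArc e (f '' A) := by
  classical
  refine ⟨fun x => if hx : ∃ y ∈ A, f y = x then θ hx.choose else 0, fun k => ?_⟩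
  obtain ⟨P, Q, hPQ⟩ := h k
  refine ⟨P, Q, fun x hx => ?_⟩
  have hx' : ∃ y ∈ A, f y = x := hx
  have h1 := hPQ _ hx'.choose_spec.1
  simp only [hx'.choose_spec.2] at h1
  simpa only [dif_pos hx'] using h1

namespace Linkage

open ComplexConjugate

variable {L : Linkage}

/-- The composition along a walk depends only on its ends. -/
lemma prod_darts_eq (S : L.Configuration) {i j : Fin L.numLinks} (w w' : L.graph.Walk i j) :
    (w.darts.map S.pos).prod = (w'.darts.map S.pos).prod := by
  have h1 := S.cycle i (w.append w'.reverse)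
  have h2 := S.cycle i (w'.append w'.reverse)
  rw [SimpleGraph.Walk.darts_append, List.map_append, List.prod_append] at h1 h2
  exact mul_right_cancel (h1.trans h2.symm)

lemma pos_mul_pos_symm (S : L.Configuration) {u v : Fin L.numLinks} (h : L.graph.Adj u v) :
    S.pos ⟨(u, v), h⟩ * S.pos ⟨(v, u), h.symm⟩ = 1 := by
  simpa using S.cycle u (.cons h (.cons h.symm .nil))

lemma lin_pos_symm (S : L.Configuration) {u v : Fin L.numLinks} (h : L.graph.Adj u v) :
    SE2.lin (S.pos ⟨(v, u), h.symm⟩) = conj (SE2.lin (S.pos ⟨(u, v), h⟩)) := by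
  rw [← SE2.lin_inv, eq_inv_of_mul_eq_one_right (pos_mul_pos_symm S h)]

/-- The linear part of the rotation at a given oriented joint, as a function of the
configuration. -/
noncomputable def linPos (L : Linkage) (d : L.graph.Dart) (S : L.Configuration) : ℂ :=
  SE2.lin (S.pos d)

/-- The relative position along a walk, as a function of the configuration. -/
noncomputable def walkPosition {i j : Fin L.numLinks} (w : L.graph.Walk i j)
    (S : L.Configuration) : L.relativePositions i j :=
  ⟨(w.darts.map S.pos).prod, S, w, rfl⟩

lemma rationalOn_walkPosition {Y : Type*} {i j : Fin L.numLinks} (w : L.graph.Walk i j)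
    {A : Set Y} {θ : Y → ℝ} (s : Y → L.Configuration)
    (h : ∀ d, CRationalOn A θ fun y => L.linPos d (s y)) (k : Fin 4) :
    RationalOn A θ fun y => SE2.coord k (walkPosition w (s y)) := by
  have key : ∀ l : List L.graph.Dart,
      CRationalOn A θ (fun y => SE2.lin (l.map (s y).pos).prod) ∧
      CRationalOn A θ (fun y => SE2.tr (l.map (s y).pos).prod) := by
    intro l
    induction l with
    | nil =>
      simp only [List.map_nil, List.prod_nil, SE2.lin_one, SE2.tr_one]
      exact ⟨.const _, .const _⟩
    | cons d l ih =>
      simp only [List.map_cons, List.prod_cons, SE2.lin_mul, SE2.tr_mul, tr_pos]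
      exact ⟨(h d).mul ih.1,
        ((h d).mul ih.2).add ((CRationalOn.const _).sub ((h d).mul (.const _)))⟩
  obtain ⟨h1, h2⟩ := key w.darts
  fin_cases k
  exacts [h1.1, h1.2, h2.1, h2.2]

lemma rationalOn_configCoord {Y : Type*} {A : Set Y} {θ : Y → ℝ} (s : Y → L.Configuration)
    (h : ∀ d, CRationalOn A θ fun y => L.linPos d (s y)) (k : L.graph.Dart × Fin 2) :
    RationalOn A θ fun y => configCoord L k (s y) := by
  obtain ⟨d, k⟩ := k
  fin_cases k
  exacts [(h d).1, (h d).2]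

lemma mobility_eq_one (hcov : HasArcCover (Set.range L.linPos)) (s : ℝ → L.Configuration)
    (hs : ∀ d, CRationalOn Set.univ id fun t => L.linPos d (s t))
    (hinf : (Set.range s).Infinite) : L.mobility = 1 := by
  classical
  obtain ⟨S, hS, hcov, hF⟩ := hcov
  rw [← Set.image_univ] at hinf
  refine topologicalKrullDim_eq_one_of_arcs (isPolyBasis_configCoord L) configCoord_injective hS
    hcov (fun A hA => ?_) (isRationalArc_image s _ _ (rationalOn_configCoord s hs)) hinf
  obtain ⟨θ, hθ⟩ := hF A hA
  exact ⟨θ, rationalOn_configCoord (fun S => S) fun d => hθ _ ⟨d, rfl⟩⟩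

lemma closure_walkPosition_mem_irreducibleComponents
    (hcov : HasArcCover (Set.range L.linPos)) (s : ℝ → L.Configuration)
    (hs : ∀ d, CRationalOn Set.univ id fun t => L.linPos d (s t)) {i j : Fin L.numLinks}
    (w : L.graph.Walk i j) (D : Set ℝ) (hinf : ((fun t => walkPosition w (s t)) '' D).Infinite) :
    closure ((fun t => walkPosition w (s t)) '' D) ∈
      irreducibleComponents (L.relativePositions i j) := by
  obtain ⟨S, hS, hcov, hF⟩ := hcov
  refine IsRationalArc.closure_mem_irreducibleComponents
    (SE2.isPolyBasis_coord.subtype (L.relativePositions i j))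
    (fun σ τ h => Subtype.ext (SE2.coord_injective h))
    (S := (fun A => walkPosition w '' A) '' S) (hS.image _)
    (Set.eq_univ_of_forall ?_) ?_
    (isRationalArc_image _ _ id fun k =>
      (rationalOn_walkPosition w s hs k).mono (Set.subset_univ D)) hinf
  · rintro ⟨σ, T, w', rfl⟩
    obtain ⟨A, hA, hTA⟩ : T ∈ ⋃₀ S := hcov ▸ Set.mem_univ T
    exact ⟨_, ⟨A, hA, rfl⟩, T, hTA, Subtype.ext (prod_darts_eq T w w')⟩
  · rintro _ ⟨A, hA, rfl⟩
    obtain ⟨θ, hθ⟩ := hF A hA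
    exact isRationalArc_image _ _ θ
      (rationalOn_walkPosition w (fun S => S) fun d => hθ _ ⟨d, rfl⟩)

lemma prod_darts_positions (g : Fin L.numLinks → SE2) {i j : Fin L.numLinks}
    (w : L.graph.Walk i j) :
    (w.darts.map fun d => (g d.fst)⁻¹ * g d.snd).prod = (g i)⁻¹ * g j := by
  induction w with
  | nil => simp
  | cons h w ih => simp [ih, mul_assoc]

/-- The configuration in which the links have prescribed absolute positions. -/
noncomputable def Configuration.ofPositions (g : Fin L.numLinks → SE2)
    (h : ∀ d : L.graph.Dart, (g d.fst)⁻¹ * g d.snd ∈ SE2.rotations (L.dartCenter d)) :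
    L.Configuration where
  pos d := (g d.fst)⁻¹ * g d.snd
  pos_mem := h
  cycle i c := by rw [prod_darts_positions, inv_mul_cancel]

end Linkage

/-! ### Ladders of antiparallelograms -/

namespace Linkage

open ComplexConjugate

/-- The ladder with `n` squares: the vertices `2 * k` and `2 * k + 1` are the ends of the rung `k`,
and the two rails join the vertices whose numbers differ by two. -/
def ladderGraph (n : ℕ) : SimpleGraph (Fin (2 * n + 2)) where
  Adj u v := u.1 + 2 = v.1 ∨ v.1 + 2 = u.1 ∨ u.1 ≠ v.1 ∧ u.1 / 2 = v.1 / 2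
  symm := ⟨fun u v h => by omega⟩
  loopless := ⟨fun u h => by omega⟩

lemma ladderGraph_adj {n : ℕ} {u v : Fin (2 * n + 2)} : (ladderGraph n).Adj u v ↔
    u.1 + 2 = v.1 ∨ v.1 + 2 = u.1 ∨ u.1 ≠ v.1 ∧ u.1 / 2 = v.1 / 2 := Iff.rfl

lemma ladderGraph_connected (n : ℕ) : (ladderGraph n).Connected := by
  rw [SimpleGraph.connected_iff_exists_forall_reachable]
  refine ⟨0, ?_⟩
  have key : ∀ m (hm : m < 2 * n + 2), (ladderGraph n).Reachable 0 ⟨m, hm⟩ := by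
    intro m
    induction m using Nat.strong_induction_on with
    | _ m ih =>
      intro hm
      rcases Nat.lt_or_ge m 2 with h | h
      · interval_cases m
        · exact SimpleGraph.Reachable.refl _
        · exact SimpleGraph.Adj.reachable (ladderGraph_adj.2 (by simp))
      · refine (ih (m - 2) (by omega) (by omega)).trans
          (SimpleGraph.Adj.reachable (ladderGraph_adj.2 (Or.inl ?_)))
        change m - 2 + 2 = m
        omega
  exact fun v => key v.1 v.2

/-- The linkage on a ladder; `rail j` is the center of the joint between the links `j` and `j + 2`,
and `rung k` that of the joint between `2 * k` and `2 * k + 1`. -/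
noncomputable def ladder (n : ℕ) (rail rung : ℕ → ℂ) : Linkage where
  numLinks := 2 * n + 2
  graph := ladderGraph n
  connected := ladderGraph_connected n
  center e := if (Sym2.inf e.1).1 + 2 = (Sym2.sup e.1).1 then rail (Sym2.inf e.1).1
    else rung ((Sym2.inf e.1).1 / 2)

variable {n : ℕ} {rail rung : ℕ → ℂ}

lemma ladder_dartCenter_rail (d : (ladder n rail rung).graph.Dart) (h : d.fst.1 + 2 = d.snd.1) :
    (ladder n rail rung).dartCenter d = rail d.fst.1 := by
  obtain ⟨⟨u, v⟩, hd⟩ := d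
  have h' : u.1 + 2 = v.1 := h
  have huv : u ≤ v := Fin.le_def.2 (by omega)
  change (if (u ⊓ v).1 + 2 = (u ⊔ v).1 then rail (u ⊓ v).1 else rung ((u ⊓ v).1 / 2)) = rail u.1
  rw [inf_eq_left.2 huv, sup_eq_right.2 huv, if_pos h']

lemma ladder_dartCenter_rung (d : (ladder n rail rung).graph.Dart) (h : d.fst.1 + 1 = d.snd.1) :
    (ladder n rail rung).dartCenter d = rung (d.fst.1 / 2) := by
  obtain ⟨⟨u, v⟩, hd⟩ := d
  have h' : u.1 + 1 = v.1 := h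
  have huv : u ≤ v := Fin.le_def.2 (by omega)
  change (if (u ⊓ v).1 + 2 = (u ⊔ v).1 then rail (u ⊓ v).1 else rung ((u ⊓ v).1 / 2)) =
    rung (u.1 / 2)
  rw [inf_eq_left.2 huv, sup_eq_right.2 huv, if_neg (by omega)]

lemma dartCenter_symm {L : Linkage} (d : L.graph.Dart) : L.dartCenter d.symm = L.dartCenter d := by
  unfold dartCenter
  congr 2
  exact d.edge_symm

lemma ladder_numJoints_le : (ladder n rail rung).numJoints ≤ 3 * n + 1 := by
  let f : Fin (2 * n) ⊕ Fin (n + 1) → Sym2 (Fin (2 * n + 2)) := Sum.elim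
    (fun i => s(⟨i.1, by omega⟩, ⟨i.1 + 2, by omega⟩))
    (fun k => s(⟨2 * k.1, by omega⟩, ⟨2 * k.1 + 1, by omega⟩))
  have h : (ladderGraph n).edgeSet ⊆ f '' Set.univ := by
    intro e he
    induction e using Sym2.ind with
    | _ u v =>
      rw [SimpleGraph.mem_edgeSet, ladderGraph_adj] at he
      have key : ∀ u v : Fin (2 * n + 2), u.1 + 2 = v.1 ∨ (u.1 % 2 = 0 ∧ u.1 + 1 = v.1) →
          ∃ x, f x = s(u, v) := by
        rintro u v (h | ⟨h0, h⟩)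
        · exact ⟨Sum.inl ⟨u.1, by omega⟩, by
            simp only [f, Sum.elim_inl]; congr 2⟩
        · refine ⟨Sum.inr ⟨u.1 / 2, by omega⟩, ?_⟩
          simp only [f, Sum.elim_inr]
          congr 2 <;> omega
      rw [Set.image_univ]
      rcases Nat.lt_or_ge u.1 v.1 with h | h
      · exact key u v (by omega)
      · rw [Sym2.eq_swap]
        exact key v u (by omega)
  calc (ladderGraph n).edgeSet.ncard ≤ (f '' Set.univ).ncard := Set.ncard_le_ncard h
    _ ≤ (Set.univ : Set (Fin (2 * n) ⊕ Fin (n + 1))).ncard := Set.ncard_image_le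
    _ = 3 * n + 1 := by rw [Set.ncard_univ, Nat.card_eq_fintype_card]; simp; omega

/-! ### The motion of a ladder -/

lemma ofReal_sub_ne_zero {α : ℂ} (hα : α.im ≠ 0) (t : ℝ) : (t : ℂ) - α ≠ 0 := by
  intro h
  apply hα
  have := congrArg Complex.im h
  simpa using this

lemma ofReal_sub_conj_ne_zero {α : ℂ} (hα : α.im ≠ 0) (t : ℝ) : (t : ℂ) - conj α ≠ 0 :=
  ofReal_sub_ne_zero (by simpa using hα) t

/-- The rotation angle at time `t` of the rotation given by the linear polynomial with non-real root
`α`. -/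
noncomputable def turn (α : ℂ) (hα : α.im ≠ 0) (t : ℝ) : Circle :=
  ⟨(t - α) / (t - conj α), by
    refine mem_sphere_zero_iff_norm.2 ?_
    rw [norm_div]
    have h : ‖(t : ℂ) - conj α‖ = ‖(t : ℂ) - α‖ := by
      rw [← Complex.norm_conj]; simp
    rw [h, div_self (norm_ne_zero_iff.2 (ofReal_sub_ne_zero hα t))]⟩

lemma coe_turn {α : ℂ} (hα : α.im ≠ 0) (t : ℝ) :
    (turn α hα t : ℂ) = (t - α) / (t - conj α) := rfl

/-- The rotation about `c` with linear part `a`. -/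
noncomputable def rot (c : ℂ) (a : Circle) : SE2 := SE2.ofLinTr a (c - a * c)

lemma rot_mem (c : ℂ) (a : Circle) : rot c a ∈ SE2.rotations c := by
  rw [SE2.mem_rotations_iff]; simp [rot]

lemma rot_apply (c : ℂ) (a : Circle) (u : ℂ) :
    (rot c a : ℂ ≃ᵃⁱ[ℝ] ℂ) u = c + a * (u - c) := by
  rw [rot, SE2.ofLinTr_apply]; ring

/-- The centers of the rungs. Two consecutive rungs, rotating with root `γ`, and the joint of the
rail between them, rotating with root `α k` around `c k`, belong to an antiparallelogram. -/
noncomputable def rungCenter (α c : ℕ → ℂ) (γ q : ℂ) : ℕ → ℂ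
  | 0 => q
  | k + 1 => rungCenter α c γ q k +
      (α k - conj (α k)) / (α k - γ) * (c k - rungCenter α c γ q k)

/-- The fourth vertex of the antiparallelogram `k`. -/
noncomputable def oppositeCenter (α c : ℕ → ℂ) (γ q : ℂ) (k : ℕ) : ℂ :=
  rungCenter α c γ q k + (α k - conj γ) / (α k - γ) * (c k - rungCenter α c γ q k)

/-- The centers of the joints on both rails. -/
noncomputable def railCenter (α c : ℕ → ℂ) (γ q : ℂ) (j : ℕ) : ℂ :=
  if j % 2 = 0 then c (j / 2) else oppositeCenter α c γ q (j / 2)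

/-- Four rotations with the same parameter `t` close up around an antiparallelogram. -/
lemma antiparallelogram_closed {α γ : ℂ} (hα : α.im ≠ 0) (hγ : γ.im ≠ 0) (hαγ : α ≠ γ) {c q q' c' : ℂ}
    (hq' : q' = q + (α - conj α) / (α - γ) * (c - q))
    (hc' : c' = q + (α - conj γ) / (α - γ) * (c - q)) (t : ℝ) :
    (rot q (turn γ hγ t))⁻¹ * (rot c (turn α hα t) * rot q' (turn γ hγ t)) ∈ SE2.rotations c' := by
  have h : ((rot c (turn α hα t) : SE2) : ℂ ≃ᵃⁱ[ℝ] ℂ) ((rot q' (turn γ hγ t) : ℂ ≃ᵃⁱ[ℝ] ℂ) c') =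
      (rot q (turn γ hγ t) : ℂ ≃ᵃⁱ[ℝ] ℂ) c' := by
    have h1 := ofReal_sub_conj_ne_zero hα t
    have h2 := ofReal_sub_conj_ne_zero hγ t
    have h3 := sub_ne_zero.2 hαγ
    rw [rot_apply, rot_apply, rot_apply, coe_turn, coe_turn, hq', hc']
    field_simp
    ring
  change ((rot q (turn γ hγ t) : SE2) : ℂ ≃ᵃⁱ[ℝ] ℂ).symm _ = c'
  rw [AffineIsometryEquiv.symm_apply_eq]
  exact h

/-- The motion of one rail: the product of the first `k` rotations. -/
noncomputable def railPosition (α c : ℕ → ℂ) (hα : ∀ k, (α k).im ≠ 0) (t : ℝ) : ℕ → SE2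
  | 0 => 1
  | k + 1 => railPosition α c hα t k * rot (c k) (turn (α k) (hα k) t)

/-- The absolute positions of the links of the ladder at time `t`. -/
noncomputable def ladderPosition (α c : ℕ → ℂ) (γ q : ℂ) (hα : ∀ k, (α k).im ≠ 0)
    (hγ : γ.im ≠ 0) (t : ℝ) (j : ℕ) : SE2 :=
  if j % 2 = 0 then railPosition α c hα t (j / 2)
  else railPosition α c hα t (j / 2) * rot (rungCenter α c γ q (j / 2)) (turn γ hγ t)

variable {α c : ℕ → ℂ} {γ q : ℂ}

lemma ladderPosition_even (hα : ∀ k, (α k).im ≠ 0) (hγ : γ.im ≠ 0) (t : ℝ) (k : ℕ) :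
    ladderPosition α c γ q hα hγ t (2 * k) = railPosition α c hα t k := by
  simp [ladderPosition]

lemma ladderPosition_odd (hα : ∀ k, (α k).im ≠ 0) (hγ : γ.im ≠ 0) (t : ℝ) (k : ℕ) :
    ladderPosition α c γ q hα hγ t (2 * k + 1) =
      railPosition α c hα t k * rot (rungCenter α c γ q k) (turn γ hγ t) := by
  have h1 : (2 * k + 1) % 2 = 1 := by omega
  have h2 : (2 * k + 1) / 2 = k := by omega
  simp [ladderPosition, h1, h2]

variable (n α c γ q) in
/-- The ladder linkage in which all squares are antiparallelograms. -/
noncomputable abbrev antiLadder : Linkage :=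
  ladder n (railCenter α c γ q) (rungCenter α c γ q)

/-- The oriented joints of a ladder, up to reversal, by type. -/
lemma ladder_dart_cases {P : (ladder n rail rung).graph.Dart → Prop}
    (hsymm : ∀ d, P d → P d.symm)
    (heven : ∀ d k, d.fst.1 = 2 * k → d.snd.1 = 2 * k + 2 → P d)
    (hodd : ∀ d k, d.fst.1 = 2 * k + 1 → d.snd.1 = 2 * k + 3 → P d)
    (hrung : ∀ d k, d.fst.1 = 2 * k → d.snd.1 = 2 * k + 1 → P d) (d) : P d := by
  have key : ∀ d : (ladder n rail rung).graph.Dart, d.fst.1 < d.snd.1 → P d := by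
    intro d hd
    have hadj := ladderGraph_adj.1 d.adj
    rcases Nat.even_or_odd' d.fst.1 with ⟨k, hk | hk⟩
    · by_cases h : d.snd.1 = 2 * k + 2
      · exact heven d k hk h
      · exact hrung d k hk (by omega)
    · exact hodd d k hk (by omega)
  have hadj := ladderGraph_adj.1 d.adj
  rcases Nat.lt_or_ge d.fst.1 d.snd.1 with h | h
  · exact key d h
  · have h' : d.symm.fst.1 < d.symm.snd.1 := by
      change d.snd.1 < d.fst.1
      omega
    simpa using hsymm _ (key d.symm h')

lemma ladderPosition_mem (hα : ∀ k, (α k).im ≠ 0) (hγ : γ.im ≠ 0) (hαγ : ∀ k, α k ≠ γ) (t : ℝ)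
    (d : (antiLadder n α c γ q).graph.Dart) :
    (ladderPosition α c γ q hα hγ t d.fst.1)⁻¹ * ladderPosition α c γ q hα hγ t d.snd.1 ∈
      SE2.rotations ((antiLadder n α c γ q).dartCenter d) := by
  induction d using ladder_dart_cases with
  | hsymm d h =>
    rw [dartCenter_symm]
    convert (SE2.rotations _).inv_mem h using 1
    rw [mul_inv_rev, inv_inv]
    rfl
  | heven d k h1 h2 =>
    rw [ladder_dartCenter_rail d (by omega), h1, h2, ladderPosition_even,
      show 2 * k + 2 = 2 * (k + 1) by ring, ladderPosition_even, railPosition, inv_mul_cancel_left]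
    simpa [railCenter] using rot_mem _ _
  | hodd d k h1 h2 =>
    rw [ladder_dartCenter_rail d (by omega), h1, h2, ladderPosition_odd,
      show 2 * k + 3 = 2 * (k + 1) + 1 by ring, ladderPosition_odd, railPosition, mul_inv_rev,
      mul_assoc, mul_assoc, inv_mul_cancel_left]
    have h3 : (2 * k + 1) % 2 ≠ 0 := by omega
    have h4 : (2 * k + 1) / 2 = k := by omega
    rw [railCenter, if_neg h3, h4]
    exact antiparallelogram_closed (hα k) hγ (hαγ k) rfl rfl t
  | hrung d k h1 h2 =>
    rw [ladder_dartCenter_rung d (by omega), h1, h2, ladderPosition_even, ladderPosition_odd,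
      inv_mul_cancel_left]
    simpa using rot_mem _ _

/-- The motion of the ladder in which all rotations have the same parameter `t`. -/
noncomputable def ladderMotion (hα : ∀ k, (α k).im ≠ 0) (hγ : γ.im ≠ 0) (hαγ : ∀ k, α k ≠ γ)
    (t : ℝ) : (antiLadder n α c γ q).Configuration :=
  Configuration.ofPositions (fun u => ladderPosition α c γ q hα hγ t u.1)
    (ladderPosition_mem hα hγ hαγ t)

lemma cRationalOn_turn {A : Set ℝ} {α : ℂ} (hα : α.im ≠ 0) :
    CRationalOn A id fun t => (turn α hα t : ℂ) :=
  (CRationalOn.param.sub (.const α)).div (CRationalOn.param.sub (.const (conj α)))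
    fun t _ => ofReal_sub_conj_ne_zero hα t

lemma cRationalOn_ladderMotion (hα : ∀ k, (α k).im ≠ 0) (hγ : γ.im ≠ 0) (hαγ : ∀ k, α k ≠ γ)
    (d : (antiLadder n α c γ q).graph.Dart) :
    CRationalOn Set.univ id fun t =>
      (antiLadder n α c γ q).linPos d (ladderMotion hα hγ hαγ t) := by
  have hrail : ∀ k, CRationalOn Set.univ id fun t => SE2.lin (railPosition α c hα t k) := by
    intro k
    induction k with
    | zero => simpa [railPosition] using CRationalOn.const 1
    | succ k ih =>
      simp only [railPosition, SE2.lin_mul]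
      simpa [rot] using ih.mul (cRationalOn_turn (hα k))
  have hpos : ∀ j, CRationalOn Set.univ id fun t =>
      SE2.lin (ladderPosition α c γ q hα hγ t j) := by
    intro j
    unfold ladderPosition
    split_ifs
    · exact hrail _
    · simp only [SE2.lin_mul]
      simpa [rot] using (hrail _).mul (cRationalOn_turn hγ)
  change CRationalOn Set.univ id fun t => SE2.lin
    ((ladderPosition α c γ q hα hγ t d.fst.1)⁻¹ * ladderPosition α c γ q hα hγ t d.snd.1)
  simp only [SE2.lin_mul, SE2.lin_inv]
  exact (hpos _).conjugate.mul (hpos _)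

lemma turn_injective {α : ℂ} (hα : α.im ≠ 0) : Function.Injective (turn α hα) := by
  intro s t h
  have h1 := congrArg ((↑) : Circle → ℂ) h
  rw [coe_turn, coe_turn, div_eq_div_iff (ofReal_sub_conj_ne_zero hα s)
    (ofReal_sub_conj_ne_zero hα t)] at h1
  have h2 : (α - conj α) * ((s : ℂ) - t) = 0 := by linear_combination h1
  have h3 : α - conj α ≠ 0 := fun h0 => hα (Complex.conj_eq_iff_im.1 (sub_eq_zero.1 h0).symm)
  exact_mod_cast sub_eq_zero.1 ((mul_eq_zero.1 h2).resolve_left h3)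

lemma range_ladderMotion_infinite (hα : ∀ k, (α k).im ≠ 0) (hγ : γ.im ≠ 0)
    (hαγ : ∀ k, α k ≠ γ) :
    (Set.range (ladderMotion (n := n) (c := c) (q := q) hα hγ hαγ)).Infinite := by
  refine Set.infinite_range_of_injective fun s t h => turn_injective hγ ?_
  have h1 := congrArg (fun S : (antiLadder n α c γ q).Configuration =>
    SE2.lin (S.pos ⟨(⟨0, Nat.succ_pos _⟩, ⟨1, by change 1 < 2 * n + 2; omega⟩),
      ladderGraph_adj.2 (by simp)⟩)) h
  have h2 : ∀ t, SE2.lin ((ladderPosition α c γ q hα hγ t (2 * 0))⁻¹ *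
      ladderPosition α c γ q hα hγ t (2 * 0 + 1)) = turn γ hγ t := fun t => by
    rw [ladderPosition_even, ladderPosition_odd, inv_mul_cancel_left]
    simp [rot]
  exact Circle.ext ((h2 s).symm.trans (h1.trans (h2 t)))

end Linkage

/-! ### All configurations of a ladder -/

namespace Linkage

open ComplexConjugate

/-- A closed quadrilateral with sides `x, y, y', x'`, where `|x| = |x'| ≠ |y| = |y'|`, has for each
direction of `y'` exactly two positions: in one of them `x' = - x`, and the other one is its
reflection. -/
lemma quadrilateral_cases {x y y' x' p b w : ℂ} (hx : x' * conj x' = x * conj x)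
    (hy : y' * conj y' = y * conj y) (hxy : x * conj x ≠ y * conj y)
    (hp : p * conj p = 1) (hb : b * conj b = 1) (hw : w * conj w = 1)
    (h : x + p * y + b * y' + w * x' = 0) :
    x + b * y' ≠ 0 ∧
      (w * x' + x = 0 ∨ w * x' * conj (x + b * y') + conj x * (x + b * y') = 0) := by
  constructor
  · intro h0
    apply hxy
    have h1 : x = -(b * y') := eq_neg_of_add_eq_zero_left h0
    rw [h1, ← hy, map_neg, map_mul]
    linear_combination y' * conj y' * hb
  · have h1 := congrArg conj h
    simp only [map_add, map_mul, map_zero] at h1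
    rw [← mul_eq_zero]
    simp only [map_add, map_mul]
    -- `D = x + b y'` and `E = w x' + x`; comparing `|D + w x'| = |y|` with `|D - x| = |y'|` shows
    -- that `D conj E` is purely imaginary.
    have h2 : (x + b * y') * (conj w * conj x' + conj x) +
        (conj x + conj b * conj y') * (w * x' + x) = 0 := by
      have h3 : (p * y) * (conj p * conj y) = (x + b * y' + w * x') *
          (conj x + conj b * conj y' + conj w * conj x') := by
        linear_combination (p * y) * h1 - (conj x + conj b * conj y' + conj w * conj x') * h
      linear_combination -h3 + y * conj y * hp - hy - y' * conj y' * hb - x' * conj x' * hw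
        - hx
    linear_combination w * x' * h2 - (x + b * y') * (hx + x' * conj x' * hw)

variable {n : ℕ} {α c : ℕ → ℂ} {γ q : ℂ}

lemma sub_conj_ne_zero {α : ℂ} (hα : α.im ≠ 0) : α - conj α ≠ 0 := fun h0 =>
  hα (Complex.conj_eq_iff_im.1 (sub_eq_zero.1 h0).symm)

/-- The sides of the antiparallelogram with given first side `c - q`. -/
lemma antiparallelogram_sides {α γ : ℂ} (hα : α.im ≠ 0) (hγ : γ.im ≠ 0) (hαγ : α ≠ γ)
    (hαγ' : α ≠ conj γ) {c q q' c' : ℂ} (hcq : c ≠ q)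
    (hq' : q' = q + (α - conj α) / (α - γ) * (c - q))
    (hc' : c' = q + (α - conj γ) / (α - γ) * (c - q)) :
    (c' - q') * conj (c' - q') = (c - q) * conj (c - q) ∧
    (q - c') * conj (q - c') = (q' - c) * conj (q' - c) ∧
    (c - q) * conj (c - q) ≠ (q' - c) * conj (q' - c) ∧ q' - c ≠ 0 ∧ c' - q' ≠ 0 := by
  have h1 := sub_ne_zero.2 hαγ
  have h2 : conj α - conj γ ≠ 0 := by
    rw [← map_sub]; exact (_root_.map_ne_zero _).2 h1
  have h3 := sub_ne_zero.2 hαγ'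
  have h4 : conj α - γ ≠ 0 := by
    have : conj (α - conj γ) ≠ 0 := (_root_.map_ne_zero _).2 h3
    simpa only [map_sub, Complex.conj_conj] using this
  have hx := sub_ne_zero.2 hcq
  have hx' : conj c - conj q ≠ 0 := by
    rw [← map_sub]; exact (_root_.map_ne_zero _).2 hx
  have e1 : c' - q' = (conj α - conj γ) / (α - γ) * (c - q) := by
    rw [hc', hq']; field_simp; ring
  have e2 : q - c' = -((α - conj γ) / (α - γ) * (c - q)) := by
    rw [hc']; ring
  have e3 : q' - c = -((conj α - γ) / (α - γ) * (c - q)) := by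
    rw [hq']; field_simp; ring
  rw [e1, e2, e3]
  simp only [map_mul, map_neg, map_div₀, map_sub, Complex.conj_conj]
  refine ⟨by field_simp, by field_simp, fun h => ?_, ?_, ?_⟩
  · have h5 : (α - conj α) * (γ - conj γ) = 0 := by
      field_simp at h
      linear_combination h
    exact mul_ne_zero (sub_conj_ne_zero hα) (sub_conj_ne_zero hγ) h5
  · exact neg_ne_zero.2 (mul_ne_zero (div_ne_zero h4 h1) hx)
  · exact mul_ne_zero (div_ne_zero h2 h1) hx

/-- The functions `linPos` of the joints among the first `k` squares of the ladder. -/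
def firstLinPos (L : Linkage) (k : ℕ) : Set (L.Configuration → ℂ) :=
  {φ | ∃ d : L.graph.Dart, d.fst.1 < 2 * k + 2 ∧ d.snd.1 < 2 * k + 2 ∧ φ = L.linPos d}

lemma linPos_symm {L : Linkage} (d : L.graph.Dart) (S : L.Configuration) :
    L.linPos d.symm S = conj (L.linPos d S) := lin_pos_symm S d.adj

lemma linPos_mul_conj {L : Linkage} (d : L.graph.Dart) (S : L.Configuration) :
    L.linPos d S * conj (L.linPos d S) = 1 := SE2.lin_mul_conj _

/-- A rational function on the unit circle becomes a rational function of `y / (1 - x)`. -/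
lemma hasArcCover_firstLinPos_zero : HasArcCover (firstLinPos (antiLadder n α c γ q) 0) := by
  let d : (antiLadder n α c γ q).graph.Dart :=
    ⟨(⟨0, Nat.succ_pos _⟩, ⟨1, by change 1 < 2 * n + 2; omega⟩), ladderGraph_adj.2 (by simp)⟩
  let φ := (antiLadder n α c γ q).linPos d
  have hF : ∀ A θ, CRationalOn A θ φ →
      ∀ ψ ∈ firstLinPos (antiLadder n α c γ q) 0, CRationalOn A θ ψ := by
    rintro A θ h _ ⟨d', h1, h2, rfl⟩
    have hadj := ladderGraph_adj.1 d'.adj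
    rcases Nat.lt_or_ge d'.fst.1 d'.snd.1 with h3 | h3
    · obtain rfl : d' = d := SimpleGraph.Dart.ext _ _ (Prod.ext
        (Fin.ext (show d'.fst.1 = 0 by omega)) (Fin.ext (show d'.snd.1 = 1 by omega)))
      exact h
    · obtain rfl : d' = d.symm := SimpleGraph.Dart.ext _ _ (Prod.ext
        (Fin.ext (show d'.fst.1 = 1 by omega)) (Fin.ext (show d'.snd.1 = 0 by omega)))
      exact h.conjugate.congr fun S _ => linPos_symm d S
  refine ⟨{{S | φ S = 1}, {S | φ S = 1}ᶜ}, by simp, by simp, ?_⟩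
  rintro A (rfl | rfl)
  · exact ⟨fun _ => 0, hF _ _ ((CRationalOn.const 1).congr fun S hS => hS)⟩
  · let u : (antiLadder n α c γ q).Configuration → ℝ := fun S => (φ S).im / (1 - (φ S).re)
    have key : ∀ S ∈ {S | φ S = 1}ᶜ, (φ S).re = (u S * u S - 1) * (u S * u S + 1)⁻¹ ∧
        (φ S).im = (2 * u S) * (u S * u S + 1)⁻¹ := by
      intro S hS
      have h0 := congrArg Complex.re (linPos_mul_conj d S)
      simp only [Complex.mul_re, Complex.conj_re, Complex.conj_im, Complex.one_re] at h0
      change (φ S).re * (φ S).re - (φ S).im * -(φ S).im = 1 at h0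
      have h1 : 1 - (φ S).re ≠ 0 := fun h1 => hS (Complex.ext (by simp; linarith) (by
        have h2 : (φ S).re = 1 := by linarith
        rw [h2] at h0
        have h3 : (φ S).im * (φ S).im = 0 := by linarith
        simpa using h3))
      have h2 : u S * u S + 1 ≠ 0 := (add_pos_of_nonneg_of_pos (mul_self_nonneg _) one_pos).ne'
      have h3 : (u S) * (1 - (φ S).re) = (φ S).im := div_mul_cancel₀ _ h1
      rw [← div_eq_mul_inv, ← div_eq_mul_inv, eq_div_iff h2, eq_div_iff h2]
      constructor
      · apply mul_right_cancel₀ (pow_ne_zero 2 h1)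
        linear_combination -(1 - (φ S).re) * (u S * (1 - (φ S).re) + (φ S).im) * h3 -
          (1 - (φ S).re) * h0
      · apply mul_right_cancel₀ (pow_ne_zero 2 h1)
        linear_combination ((φ S).im * (u S * (1 - (φ S).re) + (φ S).im) -
          2 * (1 - (φ S).re)) * h3 + (φ S).im * h0
    have hinv : RationalOn {S | φ S = 1}ᶜ u fun S => (u S * u S + 1)⁻¹ :=
      RationalOn.inv ((RationalOn.param.mul .param).add (.const 1)) fun S _ =>
        (add_pos_of_nonneg_of_pos (mul_self_nonneg _) one_pos).ne'
    exact ⟨u, hF _ _ ⟨((((RationalOn.param.mul .param).sub (.const 1)).mul hinv).congr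
      fun S hS => (key S hS).1), (((RationalOn.const 2).mul .param).mul hinv).congr
      fun S hS => (key S hS).2⟩⟩

lemma hasArcCover_firstLinPos_succ (hα : ∀ k, (α k).im ≠ 0) (hγ : γ.im ≠ 0)
    (hαγ : ∀ k, α k ≠ γ) (hαγ' : ∀ k, α k ≠ conj γ) {k : ℕ} (hk : k < n)
    (hne : c k ≠ rungCenter α c γ q k)
    (h : HasArcCover (firstLinPos (antiLadder n α c γ q) k)) :
    HasArcCover (firstLinPos (antiLadder n α c γ q) (k + 1)) := by
  obtain ⟨hx, hy, hxy, hy0, hx0⟩ := antiparallelogram_sides (hα k) hγ (hαγ k) (hαγ' k) hne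
    (q' := rungCenter α c γ q (k + 1)) (c' := oppositeCenter α c γ q k) rfl rfl
  set L := antiLadder n α c γ q with hL
  set q₀ := rungCenter α c γ q k
  set q₁ := rungCenter α c γ q (k + 1)
  set c' := oppositeCenter α c γ q k
  let v (i : ℕ) (hi : i < 4) : Fin L.numLinks :=
    ⟨2 * k + i, by change 2 * k + i < 2 * n + 2; omega⟩
  have a02 : L.graph.Adj (v 0 (by omega)) (v 2 (by omega)) :=
    ladderGraph_adj.2 (Or.inl (by simp only [v]))
  have a13 : L.graph.Adj (v 1 (by omega)) (v 3 (by omega)) :=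
    ladderGraph_adj.2 (Or.inl (by simp only [v]))
  have a01 : L.graph.Adj (v 0 (by omega)) (v 1 (by omega)) :=
    ladderGraph_adj.2 (Or.inr (Or.inr (by simp only [v]; omega)))
  have a23 : L.graph.Adj (v 2 (by omega)) (v 3 (by omega)) :=
    ladderGraph_adj.2 (Or.inr (Or.inr (by simp only [v]; omega)))
  let p := L.linPos ⟨(_, _), a02⟩
  let b₁ := L.linPos ⟨(_, _), a23⟩
  let b₀ := L.linPos ⟨(_, _), a01⟩
  let p' := L.linPos ⟨(_, _), a13⟩
  have e02 : L.dartCenter ⟨(_, _), a02⟩ = c k := by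
    refine (ladder_dartCenter_rail _ (by simp only)).trans ?_
    simp [railCenter]
  have e13 : L.dartCenter ⟨(_, _), a13⟩ = c' := by
    refine (ladder_dartCenter_rail _ (by simp only)).trans ?_
    have h1 : (2 * k + 1) % 2 ≠ 0 := by omega
    have h2 : (2 * k + 1) / 2 = k := by omega
    simp only [railCenter, if_neg h1, h2]; rfl
  have e01 : L.dartCenter ⟨(_, _), a01⟩ = q₀ := by
    refine (ladder_dartCenter_rung _ (by simp only)).trans ?_
    simp [q₀]
  have e23 : L.dartCenter ⟨(_, _), a23⟩ = q₁ := by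
    refine (ladder_dartCenter_rung _ (by simp only)).trans ?_
    have h2 : (2 * k + 2) / 2 = k + 1 := by omega
    simp only [h2]; rfl
  have hloop : ∀ S, p S * b₁ S = b₀ S * p' S ∧ (c k - q₀) + p S * (q₁ - c k) +
      b₀ S * (q₀ - c') + p S * b₁ S * (c' - q₁) = 0 := by
    intro S
    have h1 := prod_darts_eq S (.cons a02 (.cons a23 .nil)) (.cons a01 (.cons a13 .nil))
    simp only [SimpleGraph.Walk.darts_cons, SimpleGraph.Walk.darts_nil, List.map_cons,
      List.map_nil, List.prod_cons, List.prod_nil, mul_one] at h1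
    have h2 := congrArg SE2.lin h1
    have h3 := congrArg SE2.tr h1
    rw [SE2.lin_mul, SE2.lin_mul] at h2
    rw [SE2.tr_mul, SE2.tr_mul, tr_pos, tr_pos, tr_pos, tr_pos, e02, e13, e01, e23] at h3
    change p S * b₁ S = b₀ S * p' S at h2
    change p S * (q₁ - b₁ S * q₁) + (c k - p S * c k) =
      b₀ S * (c' - p' S * c') + (q₀ - b₀ S * q₀) at h3
    exact ⟨h2, by linear_combination h3 + c' * h2⟩
  have hcases : ∀ S, (c k - q₀) + b₀ S * (q₀ - c') ≠ 0 ∧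
      (p S * b₁ S * (c' - q₁) + (c k - q₀) = 0 ∨
        p S * b₁ S * (c' - q₁) * conj ((c k - q₀) + b₀ S * (q₀ - c')) +
          conj (c k - q₀) * ((c k - q₀) + b₀ S * (q₀ - c')) = 0) := fun S =>
    quadrilateral_cases hx hy hxy (linPos_mul_conj _ S) (linPos_mul_conj _ S)
      (by
        rw [map_mul]
        linear_combination b₁ S * conj (b₁ S) * linPos_mul_conj ⟨(_, _), a02⟩ S +
          linPos_mul_conj ⟨(_, _), a23⟩ S) (hloop S).2
  -- Once the rotation of the previous rung and the total rotation `p * b₁` are rational, so are all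
  -- rotations of the square.
  have hF : ∀ A θ, (∀ φ ∈ firstLinPos L k, CRationalOn A θ φ) →
      CRationalOn A θ (fun S => p S * b₁ S) →
      ∀ φ ∈ firstLinPos L (k + 1), CRationalOn A θ φ := by
    intro A θ h1 hw
    have hb₀ : CRationalOn A θ b₀ := h1 _ ⟨⟨(_, _), a01⟩, by simp, by simp, rfl⟩
    have hp : CRationalOn A θ p := by
      refine ((((CRationalOn.const (c k - q₀)).add (hb₀.mul (.const (q₀ - c')))).add
        (hw.mul (.const (c' - q₁)))).neg.mul (.const (q₁ - c k)⁻¹)).congr fun S _ => ?_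
      rw [← div_eq_mul_inv, eq_div_iff hy0]
      linear_combination (hloop S).2
    have hp' : CRationalOn A θ p' := (hb₀.conjugate.mul hw).congr fun S _ => by
      linear_combination (-p' S) * linPos_mul_conj ⟨(_, _), a01⟩ S - conj (b₀ S) * (hloop S).1
    have hb₁ : CRationalOn A θ b₁ := (hp.conjugate.mul hw).congr fun S _ => by
      linear_combination (-b₁ S) * linPos_mul_conj ⟨(_, _), a02⟩ S
    rintro _ ⟨d, hd1, hd2, rfl⟩
    by_cases hd : d.fst.1 < 2 * k + 2 ∧ d.snd.1 < 2 * k + 2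
    · exact h1 _ ⟨d, hd.1, hd.2, rfl⟩
    have hext : ∀ (d d' : L.graph.Dart), d.fst.1 = d'.fst.1 → d.snd.1 = d'.snd.1 → d = d' :=
      fun d d' h1 h2 => SimpleGraph.Dart.ext _ _ (Prod.ext (Fin.ext h1) (Fin.ext h2))
    have key : ∀ d : L.graph.Dart, d.fst.1 < d.snd.1 → d.snd.1 < 2 * (k + 1) + 2 →
        2 * k + 2 ≤ d.snd.1 → CRationalOn A θ (L.linPos d) := by
      intro d h2 h3 h4
      have hadj := ladderGraph_adj.1 d.adj
      by_cases h5 : d.snd.1 = 2 * k + 2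
      · rw [hext d ⟨(_, _), a02⟩ (by simp only; omega) h5]
        exact hp
      · by_cases h6 : d.fst.1 = 2 * k + 1
        · rw [hext d ⟨(_, _), a13⟩ h6 (by simp only; omega)]
          exact hp'
        · rw [hext d ⟨(_, _), a23⟩ (by simp only; omega) (by simp only; omega)]
          exact hb₁
    have hadj := ladderGraph_adj.1 d.adj
    rcases Nat.lt_or_ge d.fst.1 d.snd.1 with h2 | h2
    · exact key d h2 hd2 (by omega)
    · have h3 := key d.symm (show d.snd.1 < d.fst.1 by omega) hd1
        (show 2 * k + 2 ≤ d.fst.1 by omega)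
      refine h3.conjugate.congr fun S _ => ?_
      rw [linPos_symm, Complex.conj_conj]
  refine h.refine_by {S | p S * b₁ S * (c' - q₁) + (c k - q₀) = 0} ?_ ?_
  · intro A θ hA h1
    refine hF A θ h1 ((CRationalOn.const (-(c k - q₀) / (c' - q₁))).congr fun S hS => ?_)
    rw [eq_div_iff hx0]
    exact eq_neg_of_add_eq_zero_left (hA hS)
  · intro A θ hA h1
    have hb₀ : CRationalOn A θ b₀ := h1 _ ⟨⟨(_, _), a01⟩, by simp, by simp, rfl⟩
    have hD := (CRationalOn.const (A := A) (θ := θ) (c k - q₀)).add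
      (hb₀.mul (.const (q₀ - c')))
    refine hF A θ h1 ((((CRationalOn.const (conj (c k - q₀))).mul hD).neg.div
      ((CRationalOn.const (c' - q₁)).mul hD.conjugate) fun S _ => mul_ne_zero hx0
        ((_root_.map_ne_zero _).2 (hcases S).1)).congr fun S hS => ?_)
    rw [eq_div_iff (mul_ne_zero hx0 ((_root_.map_ne_zero _).2 (hcases S).1))]
    linear_combination (hcases S).2.resolve_left (hA hS)

/-- If no square degenerates, the configuration space of the ladder is a finite union of rational
arcs. -/
lemma hasArcCover_antiLadder (hα : ∀ k, (α k).im ≠ 0) (hγ : γ.im ≠ 0)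
    (hαγ : ∀ k, α k ≠ γ) (hαγ' : ∀ k, α k ≠ conj γ)
    (hne : ∀ k < n, c k ≠ rungCenter α c γ q k) :
    HasArcCover (Set.range (antiLadder n α c γ q).linPos) := by
  have key : ∀ k ≤ n, HasArcCover (firstLinPos (antiLadder n α c γ q) k) := by
    intro k
    induction k with
    | zero => exact fun _ => hasArcCover_firstLinPos_zero
    | succ k ih => exact fun hk =>
        hasArcCover_firstLinPos_succ hα hγ hαγ hαγ' hk (hne k hk) (ih (by omega))
  obtain ⟨S, hS, hcov, hF⟩ := key n le_rfl
  refine ⟨S, hS, hcov, fun A hA => ?_⟩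
  obtain ⟨θ, hθ⟩ := hF A hA
  refine ⟨θ, ?_⟩
  rintro _ ⟨d, rfl⟩
  exact hθ _ ⟨d, d.fst.2, d.snd.2, rfl⟩

lemma antiLadder_mobility (hα : ∀ k, (α k).im ≠ 0) (hγ : γ.im ≠ 0)
    (hαγ : ∀ k, α k ≠ γ) (hαγ' : ∀ k, α k ≠ conj γ)
    (hne : ∀ k < n, c k ≠ rungCenter α c γ q k) : (antiLadder n α c γ q).mobility = 1 :=
  mobility_eq_one (hasArcCover_antiLadder hα hγ hαγ hαγ' hne) (ladderMotion hα hγ hαγ)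
    (cRationalOn_ladderMotion hα hγ hαγ) (range_ladderMotion_infinite hα hγ hαγ)

/-- For a suitable center of the initial rung no square degenerates: each square excludes at most
one position, because the center of every rung is an injective function of that of the first. -/
lemma exists_nondegenerate (n : ℕ) (hαγ : ∀ k, α k ≠ γ)
    (hαγ' : ∀ k, α k ≠ conj γ) : ∃ q, ∀ k < n, c k ≠ rungCenter α c γ q k := by
  have hinj : ∀ k, Function.Injective fun q => rungCenter α c γ q k := by
    intro k
    induction k with
    | zero => exact fun q q' h => h
    | succ k ih =>
      intro q q' h
      apply ih
      have h1 := sub_ne_zero.2 (hαγ k)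
      have h2 : conj (α k) - γ ≠ 0 := by
        have : conj (α k - conj γ) ≠ 0 := (_root_.map_ne_zero _).2 (sub_ne_zero.2 (hαγ' k))
        simpa only [map_sub, Complex.conj_conj] using this
      simp only [rungCenter] at h
      field_simp at h
      apply mul_left_cancel₀ h2
      linear_combination h
  have hfin : (⋃ k ∈ Finset.range n, (fun q => rungCenter α c γ q k) ⁻¹' {c k}).Finite :=
    Set.Finite.biUnion (Finset.finite_toSet _) fun k _ =>
      (Set.finite_singleton _).preimage (hinj k).injOn
  obtain ⟨q, hq⟩ := hfin.infinite_compl.nonempty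
  refine ⟨q, fun k hk h => hq ?_⟩
  exact Set.mem_biUnion (Finset.mem_coe.2 (Finset.mem_range.2 hk)) h.symm

end Linkage

/-! ### Reduction and factorization of the parametrization -/

/-- A bounded rational curve, after cancelling the common factor `r` of its three polynomials, has a
denominator without real zeros. -/
lemma exists_reduced_of_isBounded {f g h : ℝ[X]} (hmonic : h.Monic)
    (hbounded : Bornology.IsBounded (rationalCurve f g h)) :
    ∃ r f₀ g₀ h₀ : ℝ[X], r ≠ 0 ∧ f = r * f₀ ∧ g = r * g₀ ∧ h = r * h₀ ∧ h₀.Monic ∧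
      ∀ t, h₀.eval t ≠ 0 := by
  let r := gcd h (gcd f g)
  have hh0 := hmonic.ne_zero
  have hr0 : r ≠ 0 := fun h0 => hh0 ((gcd_eq_zero_iff _ _).1 h0).1
  obtain ⟨h₀, hh⟩ : r ∣ h := gcd_dvd_left _ _
  obtain ⟨f₀, hf⟩ : r ∣ f := (gcd_dvd_right _ _).trans (gcd_dvd_left _ _)
  obtain ⟨g₀, hg⟩ : r ∣ g := (gcd_dvd_right _ _).trans (gcd_dvd_right _ _)
  have hrm : r.Monic := by
    have h1 : normalize r = r := normalize_gcd _ _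
    rw [← h1]
    exact monic_normalize hr0
  refine ⟨r, f₀, g₀, h₀, hr0, hf, hg, hh, hrm.of_mul_monic_left (hh ▸ hmonic), fun t h0 => ?_⟩
  obtain ⟨M, hM⟩ := isBounded_iff_forall_norm_le.1 hbounded
  have hdense : Dense {t | h.eval t ≠ 0} := by
    have h1 : ({t | h.eval t ≠ 0} : Set ℝ) = {t | h.eval t = 0}ᶜ := rfl
    rw [h1]
    refine Set.Countable.dense_compl ℝ (Set.Finite.countable ?_)
    exact (h.roots.toFinset.finite_toSet).subset fun t ht => by simpa [hh0] using ht
  have hle : ∀ t, |f₀.eval t| ≤ M * |h₀.eval t| ∧ |g₀.eval t| ≤ M * |h₀.eval t| := by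
    have hcl : IsClosed {t | |f₀.eval t| ≤ M * |h₀.eval t| ∧ |g₀.eval t| ≤ M * |h₀.eval t|} :=
      (isClosed_le f₀.continuous.abs (continuous_const.mul h₀.continuous.abs)).inter
        (isClosed_le g₀.continuous.abs (continuous_const.mul h₀.continuous.abs))
    intro t
    refine closure_minimal (fun t ht => ?_) hcl (hdense t)
    have h1 := hM _ ⟨t, ht, rfl⟩
    rw [Set.mem_ofPred_eq, hh, eval_mul] at ht
    have hr := left_ne_zero_of_mul ht
    have hp := abs_pos.2 (right_ne_zero_of_mul ht)
    have h2 := (Complex.abs_re_le_norm _).trans h1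
    have h3 := (Complex.abs_im_le_norm _).trans h1
    simp only [hf, hg, hh, eval_mul, mul_div_mul_left _ _ hr, abs_div, div_le_iff₀ hp] at h2 h3
    exact ⟨h2, h3⟩
  obtain ⟨h1, h2⟩ := hle t
  rw [h0, abs_zero, mul_zero] at h1 h2
  have hdvd : ∀ p : ℝ[X], p.eval t = 0 → r * (X - C t) ∣ r * p := fun p hp =>
    mul_dvd_mul_left r (dvd_iff_isRoot.2 hp)
  have h3 : r * (X - C t) ∣ r := dvd_gcd (hh ▸ hdvd h₀ h0)
    (dvd_gcd (hf ▸ hdvd f₀ (abs_nonpos_iff.1 h1)) (hg ▸ hdvd g₀ (abs_nonpos_iff.1 h2)))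
  refine not_isUnit_X_sub_C t (isUnit_of_dvd_one ((mul_dvd_mul_iff_left hr0).1 ?_))
  rwa [mul_one]

lemma exists_root_im_pos {h : ℝ[X]} (hdeg : h.natDegree ≠ 0) (h0 : ∀ t, h.eval t ≠ 0) :
    ∃ z : ℂ, 0 < z.im ∧ aeval z h = 0 := by
  obtain ⟨z, hz⟩ := IsAlgClosed.exists_aeval_eq_zero ℂ h
    (fun hd => hdeg (natDegree_eq_of_degree_eq_some hd))
  rcases lt_trichotomy z.im 0 with hlt | heq | hgt
  · refine ⟨(starRingEnd ℂ) z, by simpa using hlt, ?_⟩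
    rw [aeval_conj, hz, map_zero]
  · exfalso
    apply h0 z.re
    have h1 : z = algebraMap ℝ ℂ z.re := Complex.ext (by simp) (by simp [heq])
    rw [h1, aeval_algebraMap_apply] at hz
    simpa using hz
  · exact ⟨z, hgt, hz⟩

open ComplexConjugate in
/-- A monic real polynomial without real zeros is the product of conjugate linear factors; the
sequence `β` lists its roots in the upper half plane, followed by junk values. -/
lemma exists_conjugate_factorization (m : ℕ) : ∀ h : ℝ[X], h.natDegree ≤ m → h.Monic →
    (∀ t, h.eval t ≠ 0) → ∃ (k : ℕ) (β : ℕ → ℂ) (M : ℝ), (∀ j, 0 < (β j).im ∧ (β j).im ≤ M) ∧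
      h.natDegree = 2 * k ∧ h.map (algebraMap ℝ ℂ) =
        (∏ j ∈ Finset.range k, (X - C (β j))) * ∏ j ∈ Finset.range k, (X - C (conj (β j))) := by
  induction m with
  | zero =>
    intro h hdeg hm _
    have h1 : h = 1 := hm.natDegree_eq_zero.1 (Nat.le_zero.1 hdeg)
    exact ⟨0, fun _ => Complex.I, 1, fun _ => by simp, by simp [h1], by simp [h1]⟩
  | succ m ih =>
    intro h hdeg hm h0
    by_cases hd : h.natDegree = 0
    · exact ih h (by omega) hm h0
    obtain ⟨z, hz, hzh⟩ := exists_root_im_pos hd h0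
    obtain ⟨s, hs⟩ := h.quadratic_dvd_of_aeval_eq_zero_im_ne_zero hzh hz.ne'
    set Q : ℝ[X] := X ^ 2 - C (2 * z.re) * X + C (‖z‖ ^ 2) with hQ
    have hQd : Q.natDegree = 2 := by rw [hQ]; compute_degree!
    have hQm : Q.Monic := by rw [hQ]; monicity!
    have hsm : s.Monic := hQm.of_mul_monic_left (hs ▸ hm)
    have hdeg' : h.natDegree = 2 + s.natDegree := by rw [hs, hQm.natDegree_mul hsm, hQd]
    obtain ⟨k, β, M, hβ, hk, hfac⟩ := ih s (by omega) hsm fun t ht => h0 t (by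
      rw [hs, eval_mul, ht, mul_zero])
    refine ⟨k + 1, Function.update β k z, max M z.im, fun j => ?_, by omega, ?_⟩
    · by_cases hj : j = k
      · subst hj; simp [hz]
      · simp [hj, hβ j]
    · have hup : ∀ j ∈ Finset.range k, Function.update β k z j = β j := fun j hj => by
        rw [Function.update_of_ne (Finset.mem_range.1 hj).ne]
      rw [Finset.prod_range_succ, Finset.prod_range_succ,
        Finset.prod_congr rfl fun j hj => congrArg (fun b => X - C b) (hup j hj),
        Finset.prod_congr rfl fun j hj => congrArg (fun b => X - C (conj b)) (hup j hj),
        Function.update_self, hs, Polynomial.map_mul, hfac]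
      have hQmap : Q.map (algebraMap ℝ ℂ) = (X - C z) * (X - C (conj z)) := by
        have h1 : (2 * z.re : ℂ) = z + conj z := by rw [Complex.add_conj]; push_cast; rfl
        have h2 : (‖z‖ ^ 2 : ℂ) = z * conj z := by
          rw [Complex.mul_conj, Complex.normSq_eq_norm_sq]; push_cast; rfl
        simp only [hQ, Polynomial.map_add, Polynomial.map_sub, Polynomial.map_pow,
          Polynomial.map_mul, map_X, map_C, Complex.coe_algebraMap, Complex.ofReal_mul,
          Complex.ofReal_pow, Complex.ofReal_ofNat]
        rw [h1, h2]
        simp only [C_add, C_mul]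
        ring
      rw [hQmap]
      ring

lemma exists_re_im_polynomial (P : ℂ[X]) :
    ∃ A B : ℝ[X], ∀ t : ℝ, P.eval (t : ℂ) = ⟨A.eval t, B.eval t⟩ := by
  induction P using Polynomial.induction_on' with
  | add P Q hP hQ =>
    obtain ⟨A, B, h⟩ := hP
    obtain ⟨A', B', h'⟩ := hQ
    exact ⟨A + A', B + B', fun t => by rw [eval_add, h, h', eval_add, eval_add]; rfl⟩
  | monomial k a =>
    refine ⟨monomial k a.re, monomial k a.im, fun t => ?_⟩
    rw [eval_monomial, eval_monomial, eval_monomial]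
    rw [← Complex.ofReal_pow]
    apply Complex.ext
    · rw [Complex.re_mul_ofReal]
    · rw [Complex.im_mul_ofReal]

/-- Partial fractions with respect to two coprime monic polynomials of degree `m`. -/
lemma exists_partial_fractions {m : ℕ} {A B F : ℂ[X]} (hA : A.Monic) (hB : B.Monic)
    (hAd : A.natDegree = m) (hBd : B.natDegree = m) (hAB : IsCoprime A B)
    (hF : F.degree < (2 * m : ℕ)) :
    ∃ G H : ℂ[X], G.degree < m ∧ H.degree < m ∧ F = G * B + H * A := by
  obtain ⟨u, v, huv⟩ := hAB
  have hAd' : A.degree = m := by rw [degree_eq_natDegree hA.ne_zero, hAd]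
  have hBd' : B.degree = m := by rw [degree_eq_natDegree hB.ne_zero, hBd]
  have h1 : F * v %ₘ A + A * (F * v /ₘ A) = F * v := modByMonic_add_div _ _
  have hG : (F * v %ₘ A).degree < m := hAd' ▸ degree_modByMonic_lt _ hA
  have h2 : F = (F * v %ₘ A) * B + (F * u + (F * v /ₘ A) * B) * A := by
    linear_combination (-F) * huv - B * h1
  refine ⟨_, _, hG, ?_, h2⟩
  have h3 : (F * u + (F * v /ₘ A) * B) * A = F - (F * v %ₘ A) * B := by
    rw [eq_sub_iff_add_eq, add_comm]; exact h2.symm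
  have h4 : ((F * u + (F * v /ₘ A) * B) * A).degree < (2 * m : ℕ) := by
    rw [h3]
    refine (degree_sub_le _ _).trans_lt (max_lt hF ?_)
    by_cases hG0 : F * v %ₘ A = 0
    · rw [hG0, zero_mul, degree_zero]; exact WithBot.bot_lt_coe _
    · rw [degree_mul, hBd', degree_eq_natDegree hG0] at *
      have h5 : (F * v %ₘ A).natDegree < m := by exact_mod_cast hG
      exact_mod_cast (by omega : (F * v %ₘ A).natDegree + m < 2 * m)
  by_cases hH0 : F * u + (F * v /ₘ A) * B = 0
  · rw [hH0, degree_zero]; exact WithBot.bot_lt_coe _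
  · rw [degree_mul, hAd', degree_eq_natDegree hH0] at h4
    rw [degree_eq_natDegree hH0]
    have h5 : (F * u + (F * v /ₘ A) * B).natDegree + m < 2 * m := by exact_mod_cast h4
    exact_mod_cast (by omega : (F * u + (F * v /ₘ A) * B).natDegree < m)

/-! ### Rail motions with prescribed orbit of the origin -/

namespace Linkage

open ComplexConjugate

lemma one_sub_turn {α : ℂ} (hα : α.im ≠ 0) (t : ℝ) (c : ℂ) :
    (c - turn α hα t * c) * (t - conj α) = (α - conj α) * c := by
  have := ofReal_sub_conj_ne_zero hα t
  rw [coe_turn]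
  field_simp
  ring

lemma turn_mul {α : ℂ} (hα : α.im ≠ 0) (t : ℝ) :
    (turn α hα t : ℂ) * (t - conj α) = t - α := div_mul_cancel₀ _ (ofReal_sub_conj_ne_zero hα t)

variable {α α' c c' : ℕ → ℂ}

lemma lin_railPosition_succ (hα : ∀ k, (α k).im ≠ 0) (t : ℝ) (k : ℕ) :
    SE2.lin (railPosition α c hα t (k + 1)) =
      SE2.lin (railPosition α c hα t k) * turn (α k) (hα k) t := by
  rw [railPosition, SE2.lin_mul, rot, SE2.lin_ofLinTr]

lemma tr_railPosition_succ (hα : ∀ k, (α k).im ≠ 0) (t : ℝ) (k : ℕ) :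
    SE2.tr (railPosition α c hα t (k + 1)) = SE2.lin (railPosition α c hα t k) *
      (c k - turn (α k) (hα k) t * c k) + SE2.tr (railPosition α c hα t k) := by
  rw [railPosition, SE2.tr_mul, rot, SE2.tr_ofLinTr]

lemma railPosition_congr {hα : ∀ k, (α k).im ≠ 0} {hα' : ∀ k, (α' k).im ≠ 0} (t : ℝ) (k : ℕ)
    (h : ∀ j < k, α j = α' j ∧ c j = c' j) :
    railPosition α c hα t k = railPosition α' c' hα' t k := by
  induction k with
  | zero => rfl
  | succ k ih =>
    rw [railPosition, railPosition, ih fun j hj => h j (by omega)]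
    obtain ⟨h1, h2⟩ := h k (by omega)
    congr!

lemma railPosition_add (hα : ∀ k, (α k).im ≠ 0) (t : ℝ) (m k : ℕ) :
    railPosition α c hα t (m + k) = railPosition α c hα t m *
      railPosition (fun j => α (m + j)) (fun j => c (m + j)) (fun j => hα (m + j)) t k := by
  induction k with
  | zero => simp [railPosition]
  | succ k ih => rw [← add_assoc, railPosition, railPosition, ih, mul_assoc]

lemma lin_railPosition_mul (hα : ∀ k, (α k).im ≠ 0) (t : ℝ) (k : ℕ) :
    SE2.lin (railPosition α c hα t k) * ∏ j ∈ Finset.range k, ((t : ℂ) - conj (α j)) =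
      ∏ j ∈ Finset.range k, ((t : ℂ) - α j) := by
  induction k with
  | zero => simp [railPosition]
  | succ k ih =>
    rw [lin_railPosition_succ, Finset.prod_range_succ, Finset.prod_range_succ, ← ih,
      ← turn_mul (hα k) t]
    ring

lemma prod_sub_conj_ne_zero (hα : ∀ k, (α k).im ≠ 0) (t : ℝ) (k : ℕ) :
    ∏ j ∈ Finset.range k, ((t : ℂ) - conj (α j)) ≠ 0 :=
  Finset.prod_ne_zero_iff.2 fun j _ => ofReal_sub_conj_ne_zero (hα j) t

lemma tr_railPosition_zero (hα : ∀ k, (α k).im ≠ 0) (t : ℝ) (k : ℕ) :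
    SE2.tr (railPosition α (fun _ => 0) hα t k) = 0 := by
  induction k with
  | zero => rfl
  | succ k ih => rw [tr_railPosition_succ, ih]; simp

/-- The homogeneous coordinates `Z, W` of a product of rotations are polynomials in the
parameter. -/
lemma exists_polynomial_coords (hα : ∀ k, (α k).im ≠ 0) (k : ℕ) :
    ∃ Z W : ℂ[X], ∀ t : ℝ, Z.eval (t : ℂ) ≠ 0 ∧
      SE2.lin (railPosition α c hα t k) * conj (Z.eval (t : ℂ)) = Z.eval (t : ℂ) ∧
      SE2.tr (railPosition α c hα t k) * conj (Z.eval (t : ℂ)) = W.eval (t : ℂ) := by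
  induction k with
  | zero => exact ⟨1, 0, fun t => by simp [railPosition]⟩
  | succ k ih =>
    obtain ⟨Z, W, h⟩ := ih
    refine ⟨Z * (X - C (α k)), Z * C ((α k - conj (α k)) * c k) + W * (X - C (conj (α k))),
      fun t => ?_⟩
    obtain ⟨h0, h1, h2⟩ := h t
    simp only [eval_mul, eval_sub, eval_X, eval_C, eval_add, map_mul, map_sub, Complex.conj_ofReal,
      lin_railPosition_succ, tr_railPosition_succ]
    refine ⟨mul_ne_zero h0 (ofReal_sub_ne_zero (hα k) t), ?_, ?_⟩
    · linear_combination turn (α k) (hα k) t * (t - conj (α k)) * h1 +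
        Z.eval (t : ℂ) * turn_mul (hα k) t
    · linear_combination (c k - turn (α k) (hα k) t * c k) * (t - conj (α k)) * h1 +
        Z.eval (t : ℂ) * one_sub_turn (hα k) t (c k) + (t - conj (α k)) * h2

/-- By a choice of the centers, `m` rotations with given roots can move the origin along any curve
`G / ∏ (t - conj (α j))` with `deg G < m`, provided that no root is conjugate to another: the last
center is determined by the value of `G` at `conj (α (m - 1))`. -/
lemma exists_centers (hα : ∀ k, (α k).im ≠ 0) (hne : ∀ i j, conj (α i) ≠ α j) (m : ℕ) :
    ∀ G : ℂ[X], G.degree < m → ∃ c : ℕ → ℂ, ∀ t : ℝ, SE2.tr (railPosition α c hα t m) *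
      ∏ j ∈ Finset.range m, ((t : ℂ) - conj (α j)) = G.eval (t : ℂ) := by
  induction m with
  | zero =>
    intro G hG
    have hG0 : G = 0 := degree_eq_bot.1 (Nat.WithBot.lt_zero_iff.1 (by simpa using hG))
    exact ⟨fun _ => 0, fun t => by simp [railPosition, hG0]⟩
  | succ m ih =>
    intro G hG
    let A : ℂ[X] := ∏ j ∈ Finset.range m, (X - C (α j))
    have hA : A.degree = m := by simp [A, degree_prod]
    have hA0 : A.eval (conj (α m)) ≠ 0 := by
      simp only [A, eval_prod, eval_sub, eval_X, eval_C]
      exact Finset.prod_ne_zero_iff.2 fun j _ => sub_ne_zero.2 (hne m j)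
    let w := G.eval (conj (α m)) / A.eval (conj (α m))
    obtain ⟨H, hH⟩ : X - C (conj (α m)) ∣ G - C w * A := by
      rw [dvd_iff_isRoot, IsRoot, eval_sub, eval_mul, eval_C, div_mul_cancel₀ _ hA0, sub_self]
    have hHd : H.degree < m := by
      have h1 : (G - C w * A).degree < (m + 1 : ℕ) := by
        refine (degree_sub_le _ _).trans_lt (max_lt hG ?_)
        refine (degree_mul_le_of_le degree_C_le hA.le).trans_lt ?_
        rw [zero_add]
        exact_mod_cast Nat.lt_succ_self m
      by_cases hH0 : H = 0
      · rw [hH0, degree_zero]; exact WithBot.bot_lt_coe _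
      · rw [hH, degree_mul, degree_X_sub_C, degree_eq_natDegree hH0] at h1
        rw [degree_eq_natDegree hH0]
        have h2 : 1 + H.natDegree < m + 1 := by exact_mod_cast h1
        exact_mod_cast (by omega : H.natDegree < m)
    obtain ⟨c, hc⟩ := ih H hHd
    refine ⟨Function.update c m (w / (α m - conj (α m))), fun t => ?_⟩
    have h1 : railPosition α (Function.update c m (w / (α m - conj (α m)))) hα t m =
        railPosition α c hα t m := railPosition_congr t m fun j hj =>
      ⟨rfl, Function.update_of_ne hj.ne _ _⟩
    have h2 := congrArg (eval (t : ℂ)) hH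
    simp only [eval_sub, eval_mul, eval_C, eval_X, A, eval_prod] at h2
    have h3 := one_sub_turn (hα m) t (w / (α m - conj (α m)))
    rw [mul_div_cancel₀ _ (sub_conj_ne_zero (hα m))] at h3
    rw [tr_railPosition_succ, h1, Finset.prod_range_succ, Function.update_self]
    linear_combination (SE2.lin (railPosition α c hα t m) *
      ∏ j ∈ Finset.range m, ((t : ℂ) - conj (α j))) * h3 + w * lin_railPosition_mul hα t m (c := c)
      + (t - conj (α m)) * hc t - h2

/-- The roots of the rail motion: the conjugates of the given numbers, and twice these numbers. -/
def railRoots (m : ℕ) (β : ℕ → ℂ) (k : ℕ) : ℂ :=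
  if k < m then conj (β k) else if k < 2 * m then β (k - m) else β (k - 2 * m)

lemma railRoots_im_ne_zero {m : ℕ} {β : ℕ → ℂ} (hβ : ∀ j, 0 < (β j).im) (k : ℕ) :
    (railRoots m β k).im ≠ 0 := by
  unfold railRoots
  split_ifs
  · simpa using (hβ k).ne'
  · exact (hβ _).ne'
  · exact (hβ _).ne'

/-- A product of `3 m` rotations under which the origin has a prescribed rational orbit with
denominator `∏ (t - β j) (t - conj (β j))`. After the first `m` rotations, which contribute the
summand with denominator `∏ (t - β j)`, the next `m` rotations, around the origin, undo the
total rotation; the last `m` contribute the summand with denominator `∏ (t - conj (β j))`. -/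
lemma exists_railMotion {m : ℕ} {β : ℕ → ℂ} (hβ : ∀ j, 0 < (β j).im) {F : ℂ[X]}
    (hF : F.degree < (2 * m : ℕ)) : ∃ c : ℕ → ℂ, ∀ t : ℝ,
      SE2.tr (railPosition (railRoots m β) c (railRoots_im_ne_zero hβ) t (3 * m)) *
        ((∏ j ∈ Finset.range m, ((t : ℂ) - β j)) *
          ∏ j ∈ Finset.range m, ((t : ℂ) - conj (β j))) = F.eval (t : ℂ) ∧
      SE2.lin (railPosition (railRoots m β) c (railRoots_im_ne_zero hβ) t (3 * m)) *
        ∏ j ∈ Finset.range m, ((t : ℂ) - conj (β j)) =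
          ∏ j ∈ Finset.range m, ((t : ℂ) - β j) := by
  have hne : ∀ i j, conj (β i) ≠ β j := fun i j h => by
    have h1 := congrArg Complex.im h
    rw [Complex.conj_im] at h1
    linarith [hβ i, hβ j]
  have hβ1 : ∀ j, (β j).im ≠ 0 := fun j => (hβ j).ne'
  have hβ2 : ∀ j, (conj (β j)).im ≠ 0 := fun j => by simpa using (hβ j).ne'
  obtain ⟨G, H, hG, hH, hFGH⟩ := exists_partial_fractions (m := m) (F := F)
    (A := ∏ j ∈ Finset.range m, (X - C (β j))) (B := ∏ j ∈ Finset.range m, (X - C (conj (β j))))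
    (monic_prod_of_monic _ _ fun j _ => monic_X_sub_C _)
    (monic_prod_of_monic _ _ fun j _ => monic_X_sub_C _) (by simp [natDegree_prod_of_monic, monic_X_sub_C])
    (by simp [natDegree_prod_of_monic, monic_X_sub_C])
    (IsCoprime.prod_left fun i _ => IsCoprime.prod_right fun j _ =>
      isCoprime_X_sub_C_of_isUnit_sub (sub_ne_zero.2 (hne j i).symm).isUnit) hF
  obtain ⟨c₁, hc₁⟩ := exists_centers hβ2 (fun i j => by
    simpa using (hne j i).symm) m G hG
  obtain ⟨c₃, hc₃⟩ := exists_centers hβ1 hne m H hH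
  refine ⟨fun k => if k < m then c₁ k else if k < 2 * m then 0 else c₃ (k - 2 * m), fun t => ?_⟩
  have hsplit : railPosition (railRoots m β) (fun k => if k < m then c₁ k else
      if k < 2 * m then 0 else c₃ (k - 2 * m)) (railRoots_im_ne_zero hβ) t (3 * m) =
      railPosition (fun j => conj (β j)) c₁ hβ2 t m *
        (railPosition β (fun _ => 0) hβ1 t m * railPosition β c₃ hβ1 t m) := by
    rw [show 3 * m = m + (m + m) by ring, railPosition_add, railPosition_add]
    congr 1
    · refine railPosition_congr t m fun j hj => ?_
      simp [railRoots, hj]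
    · congr 1
      · refine railPosition_congr t m fun j hj => ?_
        have h1 : m + j < 2 * m := by omega
        simp [railRoots, h1]
      · refine railPosition_congr t m fun j hj => ?_
        have h1 : ¬ m + (m + j) < m := by omega
        have h2 : ¬ m + (m + j) < 2 * m := by omega
        have h3 : m + (m + j) - 2 * m = j := by omega
        simp only [railRoots, if_neg h1, if_neg h2, h3, and_self]
  have h1 := lin_railPosition_mul hβ2 t m (c := c₁)
  have h2 := lin_railPosition_mul hβ1 t m (c := fun _ => 0)
  have h3 := lin_railPosition_mul hβ1 t m (c := c₃)
  have h4 := hc₁ t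
  simp only [Complex.conj_conj] at h1 h4
  have hB := prod_sub_conj_ne_zero hβ1 t m
  have hA := prod_sub_conj_ne_zero hβ2 t m
  simp only [Complex.conj_conj] at hA
  have h5 : SE2.lin (railPosition (fun j => conj (β j)) c₁ hβ2 t m) *
      SE2.lin (railPosition β (fun _ => 0) hβ1 t m) = 1 := by
    apply mul_right_cancel₀ (mul_ne_zero hA hB)
    rw [mul_mul_mul_comm, h1, h2]
    ring
  have h6 := congrArg (eval (t : ℂ)) hFGH
  simp only [eval_add, eval_mul, eval_prod, eval_sub, eval_X, eval_C] at h6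
  rw [hsplit, SE2.tr_mul, SE2.tr_mul, SE2.lin_mul, SE2.lin_mul, tr_railPosition_zero]
  constructor
  · linear_combination (∏ j ∈ Finset.range m, ((t : ℂ) - β j)) *
      (∏ j ∈ Finset.range m, ((t : ℂ) - conj (β j))) * SE2.tr (railPosition β c₃ hβ1 t m) * h5 +
      (∏ j ∈ Finset.range m, ((t : ℂ) - conj (β j))) * h4 +
      (∏ j ∈ Finset.range m, ((t : ℂ) - β j)) * hc₃ t - h6
  · linear_combination SE2.lin (railPosition β c₃ hβ1 t m) *
      (∏ j ∈ Finset.range m, ((t : ℂ) - conj (β j))) * h5 + h3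

/-- A motion whose linear part is `∏ (t - β j) / (t - conj (β j))`, with at least one factor and all
`β j` in the upper half plane, takes infinitely many positions. -/
lemma infinite_image_of_lin {m : ℕ} (hm : m ≠ 0) {β : ℕ → ℂ} (hβ : ∀ j, 0 < (β j).im)
    {Y : Type*} (l : Y → ℂ) (hl : ∀ x, l x ≠ 0) (s : ℝ → Y)
    (h : ∀ t, l (s t) * ∏ j ∈ Finset.range m, ((t : ℂ) - conj (β j)) =
      ∏ j ∈ Finset.range m, ((t : ℂ) - β j)) {D : Set ℝ} (hD : D.Infinite) :
    (s '' D).Infinite := by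
  intro hfin
  refine hD (Set.Finite.of_finite_fibers s hfin fun x _ => ?_)
  let P : ℂ[X] := (∏ j ∈ Finset.range m, (X - C (β j))) -
    C (l x) * ∏ j ∈ Finset.range m, (X - C (conj (β j)))
  have hP : P ≠ 0 := by
    intro hP
    have h1 := congrArg (eval (β 0)) hP
    simp only [P, eval_sub, eval_mul, eval_prod, eval_X, eval_C, eval_zero] at h1
    rw [Finset.prod_eq_zero (Finset.mem_range.2 (Nat.pos_of_ne_zero hm)) (sub_self (β 0)), zero_sub,
      neg_eq_zero, mul_eq_zero, or_iff_right (hl x), Finset.prod_eq_zero_iff] at h1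
    obtain ⟨j, -, hj⟩ := h1
    have h2 := congrArg Complex.im hj
    rw [Complex.sub_im, Complex.conj_im, Complex.zero_im] at h2
    linarith [hβ 0, hβ j]
  refine Set.Finite.of_finite_image (f := ((↑) : ℝ → ℂ)) ?_ Complex.ofReal_injective.injOn
  refine P.roots.toFinset.finite_toSet.subset ?_
  rintro _ ⟨t, ⟨-, ht⟩, rfl⟩
  have ht' : s t = x := ht
  have h1 := h t
  rw [ht'] at h1
  simp only [Finset.mem_coe, Multiset.mem_toFinset, mem_roots hP, IsRoot.def, P, eval_sub, eval_mul,
    eval_prod, eval_X, eval_C, h1, sub_self]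

/-! ### The linkage drawing a curve -/

variable {n : ℕ} {γ q : ℂ}

lemma walkPosition_ladderMotion (hα : ∀ k, (α k).im ≠ 0) (hγ : γ.im ≠ 0) (hαγ : ∀ k, α k ≠ γ)
    {i j : Fin (antiLadder n α c γ q).numLinks} (w : (antiLadder n α c γ q).graph.Walk i j)
    (t : ℝ) : (walkPosition w (ladderMotion hα hγ hαγ t) : SE2) =
      (ladderPosition α c γ q hα hγ t i.1)⁻¹ * ladderPosition α c γ q hα hγ t j.1 :=
  prod_darts_positions (fun u => ladderPosition α c γ q hα hγ t u.1) w

/-- The ladder draws the orbit of the origin under its rail motion, restricted to the parameters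
with `r t ≠ 0`. -/
lemma antiLadder_draws (hα : ∀ k, (α k).im ≠ 0) (hγ : γ.im ≠ 0) (hαγ : ∀ k, α k ≠ γ)
    {r : ℝ[X]} (hr : r ≠ 0)
    (hcomp : ∀ (i j : Fin (antiLadder n α c γ q).numLinks) (_ : i.1 = 0) (_ : j.1 = 2 * n)
      (w : (antiLadder n α c γ q).graph.Walk i j),
      closure ((fun t => walkPosition w (ladderMotion hα hγ hαγ t)) '' {t | r.eval t ≠ 0}) ∈
        irreducibleComponents ((antiLadder n α c γ q).relativePositions i j)) :
    (antiLadder n α c γ q).Draws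
      {u | ∃ t, r.eval t ≠ 0 ∧ u = SE2.tr (railPosition α c hα t n)} := by
  obtain ⟨Z, W, hZW⟩ := exists_polynomial_coords (c := c) hα n
  obtain ⟨A, B, hAB⟩ := exists_re_im_polynomial Z
  obtain ⟨A', B', hAB'⟩ := exists_re_im_polynomial W
  have hcoords : ∀ t, r.eval t ≠ 0 → SE2.HasCoords
      (fun k => ((![r * A, r * B, r * A', r * B'] : Fin 4 → ℝ[X]) k).eval t)
      (railPosition α c hα t n) := by
    intro t ht
    obtain ⟨h0, h1, h2⟩ := hZW t
    rw [SE2.hasCoords_iff]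
    change (r * A).eval t ^ 2 + (r * B).eval t ^ 2 ≠ 0 ∧
      _ * (((r * A).eval t ^ 2 + (r * B).eval t ^ 2 : ℝ) : ℂ) =
        (⟨(r * A).eval t, (r * B).eval t⟩ : ℂ) ^ 2 ∧
      _ * (((r * A).eval t ^ 2 + (r * B).eval t ^ 2 : ℝ) : ℂ) =
        (⟨(r * A).eval t, (r * B).eval t⟩ : ℂ) * ⟨(r * A').eval t, (r * B').eval t⟩
    have e1 : (⟨(r * A).eval t, (r * B).eval t⟩ : ℂ) = ((r.eval t : ℝ) : ℂ) * Z.eval (t : ℂ) := by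
      rw [hAB, eval_mul, eval_mul]; apply Complex.ext <;> simp
    have e2 : (⟨(r * A').eval t, (r * B').eval t⟩ : ℂ) = ((r.eval t : ℝ) : ℂ) * W.eval (t : ℂ) := by
      rw [hAB', eval_mul, eval_mul]; apply Complex.ext <;> simp
    rw [SE2.ofReal_sq_add_sq, e1, e2, map_mul, Complex.conj_ofReal]
    refine ⟨fun h => ?_, ?_, ?_⟩
    · have h3 := congrArg ((↑) : ℝ → ℂ) h
      rw [SE2.ofReal_sq_add_sq, e1, Complex.ofReal_zero, map_mul, Complex.conj_ofReal] at h3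
      have h4 : ((r.eval t : ℝ) : ℂ) ≠ 0 := Complex.ofReal_ne_zero.2 ht
      exact mul_ne_zero (mul_ne_zero h4 h0)
        (mul_ne_zero h4 ((_root_.map_ne_zero _).2 h0)) h3
    · linear_combination ((r.eval t : ℝ) : ℂ) ^ 2 * Z.eval (t : ℂ) * h1
    · linear_combination ((r.eval t : ℝ) : ℂ) ^ 2 * Z.eval (t : ℂ) * h2
  have hzero : ∀ t, r.eval t = 0 →
      (fun k => ((![r * A, r * B, r * A', r * B'] : Fin 4 → ℝ[X]) k).eval t) = 0 := by
    intro t ht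
    funext k
    fin_cases k <;> simp [ht]
  have hDinf : {t : ℝ | r.eval t ≠ 0}.Infinite := by
    refine Set.Finite.infinite_compl (s := {t | r.eval t = 0}) ?_
    exact (r.roots.toFinset.finite_toSet).subset fun t ht => by simpa [hr] using ht
  let Φ : RationalMotion :=
    { poly := ![r * A, r * B, r * A', r * B']
      ne_zero := by
        obtain ⟨t, ht⟩ := hDinf.nonempty
        intro h
        apply (hcoords t ht).1
        simpa using congrArg (eval t) h }
  have huniq : ∀ t σ, SE2.HasCoords (Φ.coords t) σ →
      r.eval t ≠ 0 ∧ σ = railPosition α c hα t n := by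
    intro t σ h
    have ht : r.eval t ≠ 0 := fun ht => h.1 (by
      have := hzero t ht
      change Φ.coords t = 0 at this
      simp [this])
    refine ⟨ht, Subtype.ext (AffineIsometryEquiv.ext fun u => ?_)⟩
    rw [h.2 u, (hcoords t ht).2 u]
    rfl
  have himage : ∀ σ, σ ∈ Φ.image ↔ ∃ t, r.eval t ≠ 0 ∧ σ = railPosition α c hα t n :=
    fun σ => ⟨fun ⟨t, h⟩ => ⟨t, huniq t σ h⟩, fun ⟨t, ht, h⟩ => ⟨t, h ▸ hcoords t ht⟩⟩
  let i : Fin (antiLadder n α c γ q).numLinks := ⟨0, Nat.succ_pos _⟩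
  let j : Fin (antiLadder n α c γ q).numLinks := ⟨2 * n, Nat.lt_add_of_pos_right two_pos⟩
  obtain ⟨w⟩ : (antiLadder n α c γ q).graph.Reachable i j :=
    (antiLadder n α c γ q).connected.preconnected i j
  have hwalk : ∀ t, (walkPosition w (ladderMotion hα hγ hαγ t) : SE2) =
      railPosition α c hα t n := by
    intro t
    refine (walkPosition_ladderMotion hα hγ hαγ w t).trans ?_
    change (ladderPosition α c γ q hα hγ t (2 * 0))⁻¹ * ladderPosition α c γ q hα hγ t (2 * n) = _
    rw [ladderPosition_even, ladderPosition_even]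
    simp [railPosition]
  refine ⟨Φ, ⟨i, j, fun t ht => ?_, ?_⟩, 0, ?_⟩
  · have ht' : r.eval t ≠ 0 := fun h => ht (hzero t h)
    refine ⟨_, (walkPosition w (ladderMotion hα hγ hαγ t)).2, ?_⟩
    rw [hwalk]
    exact hcoords t ht'
  · convert hcomp i j rfl rfl w using 2
    ext σ
    rw [Set.mem_preimage, himage]
    constructor
    · rintro ⟨t, ht, h⟩
      exact ⟨t, ht, Subtype.ext ((hwalk t).trans h.symm)⟩
    · rintro ⟨t, ht, rfl⟩
      exact ⟨t, ht, hwalk t⟩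
  · ext u
    constructor
    · rintro ⟨σ, hσ, rfl⟩
      obtain ⟨t, ht, rfl⟩ := (himage σ).1 hσ
      exact ⟨t, ht, rfl⟩
    · rintro ⟨t, ht, rfl⟩
      exact ⟨_, (himage _).2 ⟨t, ht, rfl⟩, rfl⟩

lemma closure_mem_irreducibleComponents_of_subsingleton {X : Type*} [TopologicalSpace X]
    [Subsingleton X] {s : Set X} (hs : s.Nonempty) : closure s ∈ irreducibleComponents X := by
  have h : ∀ s : Set X, s.Nonempty → s = Set.univ := fun s => Subsingleton.eq_univ_of_nonempty
  have hirr : IsIrreducible (closure s) :=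
    ⟨hs.closure, (Set.subsingleton_of_subsingleton).isPreirreducible⟩
  exact ⟨hirr, fun t ht _ => (h _ hs.closure).symm ▸ Set.subset_univ t⟩

end Linkage

open Linkage ComplexConjugate in
theorem mainTheorem3 (f g h : ℝ[X]) (hmonic : h.Monic)
    (hf : f.degree < h.degree) (hg : g.degree < h.degree)
    (hbounded : Bornology.IsBounded (rationalCurve f g h)) :
    ∃ L : Linkage,
      L.numLinks ≤ 3 * h.natDegree + 2 ∧
      (L.numJoints : ℝ) ≤ 9 / 2 * (h.natDegree : ℝ) + 1 ∧
      L.mobility = 1 ∧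
      L.Draws (rationalCurve f g h) := by
  obtain ⟨r, f₀, g₀, h₀, hr, hff, hgg, hhh, hm₀, h0⟩ := exists_reduced_of_isBounded hmonic hbounded
  obtain ⟨m, β, M, hβ, hdeg, hfac⟩ := exists_conjugate_factorization _ h₀ le_rfl hm₀ h0
  have hcancel : ∀ p : ℝ[X], (r * p).degree < h.degree → p.degree < (2 * m : ℕ) := by
    intro p hp
    by_cases hp0 : p = 0
    · rw [hp0, degree_zero]; exact WithBot.bot_lt_coe _
    · rw [hhh, degree_mul, degree_mul, degree_eq_natDegree hr, degree_eq_natDegree hp0,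
        degree_eq_natDegree hm₀.ne_zero, hdeg] at hp
      rw [degree_eq_natDegree hp0]
      have h1 : r.natDegree + p.natDegree < r.natDegree + 2 * m := by exact_mod_cast hp
      exact_mod_cast (by omega : p.natDegree < 2 * m)
  have hnat : 2 * m ≤ h.natDegree := by
    rw [hhh, natDegree_mul hr hm₀.ne_zero, hdeg]
    exact Nat.le_add_left _ _
  let F : ℂ[X] := f₀.map (algebraMap ℝ ℂ) + C Complex.I * g₀.map (algebraMap ℝ ℂ)
  have hF : F.degree < (2 * m : ℕ) := by
    refine (degree_add_le _ _).trans_lt (max_lt ?_ ?_)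
    · rw [degree_map]; exact hcancel _ (hff ▸ hf)
    · rw [degree_C_mul Complex.I_ne_zero, degree_map]; exact hcancel _ (hgg ▸ hg)
  have hβ0 := fun j => (hβ j).1
  obtain ⟨c, hc⟩ := exists_railMotion hβ0 hF
  have hα := railRoots_im_ne_zero (m := m) hβ0
  -- The rungs rotate with a root lying above all roots of the rail motion and their conjugates.
  let γ : ℂ := ⟨0, M + 1⟩
  have hM : 0 < M := (hβ 0).1.trans_le (hβ 0).2
  have hγ : γ.im ≠ 0 := (by positivity : (0 : ℝ) < M + 1).ne'
  have hbound : ∀ k, |(railRoots m β k).im| ≤ M := by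
    intro k
    unfold railRoots
    split_ifs
    · rw [Complex.conj_im, abs_neg, abs_of_pos (hβ _).1]; exact (hβ _).2
    · rw [abs_of_pos (hβ _).1]; exact (hβ _).2
    · rw [abs_of_pos (hβ _).1]; exact (hβ _).2
  have hαγ : ∀ k, railRoots m β k ≠ γ := fun k hk => by
    have h1 := (le_abs_self _).trans (hbound k)
    rw [hk] at h1
    exact absurd h1 (not_le.2 (lt_add_one M))
  have hαγ' : ∀ k, railRoots m β k ≠ conj γ := fun k hk => by
    have h1 := (neg_le_abs _).trans (hbound k)
    rw [hk, Complex.conj_im, neg_neg] at h1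
    exact absurd h1 (not_le.2 (lt_add_one M))
  obtain ⟨q, hq⟩ := exists_nondegenerate (c := c) (3 * m) hαγ hαγ'
  refine ⟨antiLadder (3 * m) (railRoots m β) c γ q, ?_, ?_,
    antiLadder_mobility hα hγ hαγ hαγ' hq, ?_⟩
  · change 2 * (3 * m) + 2 ≤ _
    omega
  · have h1 : ((antiLadder (3 * m) (railRoots m β) c γ q).numJoints : ℝ) ≤
        ((3 * (3 * m) + 1 : ℕ) : ℝ) := Nat.cast_le.2 ladder_numJoints_le
    have h2 : ((2 * m : ℕ) : ℝ) ≤ h.natDegree := Nat.cast_le.2 hnat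
    push_cast at h1 h2
    linarith
  · have hcurve : rationalCurve f g h = {u | ∃ t, r.eval t ≠ 0 ∧
        u = SE2.tr (railPosition (railRoots m β) c hα t (3 * m))} := by
      have htr : ∀ t, SE2.tr (railPosition (railRoots m β) c hα t (3 * m)) =
          ⟨f₀.eval t / h₀.eval t, g₀.eval t / h₀.eval t⟩ := by
        intro t
        have h1 := congrArg (eval (t : ℂ)) hfac
        simp only [eval_mul, eval_prod, eval_sub, eval_X, eval_C] at h1
        have hreal : ∀ p : ℝ[X], (p.map (algebraMap ℝ ℂ)).eval (t : ℂ) = ((p.eval t : ℝ) : ℂ) :=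
          fun p => by
            rw [eval_map, ← Complex.coe_algebraMap, eval₂_at_apply]
        have h2 := (hc t).1
        rw [← h1, hreal] at h2
        simp only [F, eval_add, eval_mul, eval_C, hreal] at h2
        have h3 : ((h₀.eval t : ℝ) : ℂ) ≠ 0 := Complex.ofReal_ne_zero.2 (h0 t)
        rw [← eq_div_iff h3] at h2
        rw [h2]
        apply Complex.ext
        · rw [Complex.div_ofReal_re]; simp
        · rw [Complex.div_ofReal_im]; simp
      ext u
      refine exists_congr fun t => ?_
      rw [htr, hff, hgg, hhh]
      simp only [eval_mul]
      constructor
      · rintro ⟨ht, rfl⟩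
        have hrt := left_ne_zero_of_mul ht
        exact ⟨hrt, by rw [mul_div_mul_left _ _ hrt, mul_div_mul_left _ _ hrt]⟩
      · rintro ⟨hrt, rfl⟩
        exact ⟨mul_ne_zero hrt (h0 t), by
          rw [mul_div_mul_left _ _ hrt, mul_div_mul_left _ _ hrt]⟩
    have hDinf : {t : ℝ | r.eval t ≠ 0}.Infinite := by
      refine Set.Finite.infinite_compl (s := {t | r.eval t = 0}) ?_
      exact (r.roots.toFinset.finite_toSet).subset fun t ht => by simpa [hr] using ht
    rw [hcurve]
    refine antiLadder_draws hα hγ hαγ hr fun i j hi hj w => ?_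
    by_cases hm : m = 0
    · have hij : i = j := Fin.ext (by rw [hi, hj, hm])
      subst hij
      have : Subsingleton ((antiLadder (3 * m) (railRoots m β) c γ q).relativePositions i i) := by
        refine ⟨?_⟩
        rintro ⟨_, S, v, rfl⟩ ⟨_, T, v', rfl⟩
        exact Subtype.ext ((S.cycle i v).trans (T.cycle i v').symm)
      exact closure_mem_irreducibleComponents_of_subsingleton (hDinf.nonempty.image _)
    · refine closure_walkPosition_mem_irreducibleComponents
        (hasArcCover_antiLadder hα hγ hαγ hαγ' hq) _ (cRationalOn_ladderMotion hα hγ hαγ) w _ ?_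
      refine infinite_image_of_lin hm hβ0 (fun σ => SE2.lin σ.1) (fun σ => SE2.lin_ne_zero _) _
        (fun t => ?_) hDinf
      rw [walkPosition_ladderMotion, hi, hj, ladderPosition_even,
        show (0 : ℕ) = 2 * 0 from rfl, ladderPosition_even]
      simpa [railPosition] using (hc t).2
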